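/- **Setting.** A tensor network is a hypergraph $G=(V,E,w)$: vertices are tensors, a hyperedge $e$ is a dimension of size $\exp(w(e))$, a positive integer, and has at least two ends, one of which may be dangling (then $e$ is uncontracted). For $A,B\subseteq V$ let $E(A,B)$ be the set of hyperedges adjacent to both $A$ and $B$, and $E(A)=E(A,V\setminus A)\cup E(A,*)$, where $E(A,*)$ is the set of uncontracted hyperedges adjacent to $A$ only. Put $\mathrm{cut}_G(A,B)=\sum_{e\in E(A,B)}w(e)$ and $\mathrm{cut}_G(A)=\sum_{e\in E(A)}w(e)$. A contraction tree is a rooted binary tree whose leaves are the tensors, each exactly once; its inner vertices are contractions $(A,B)$ of disjoint vertex sets. Each contraction costs $\exp(\mathrm{cut}_G(A)+\mathrm{cut}_G(B)-\mathrm{cut}_G(A,B))$, and the cost of a tree is the sum over its contractions. The data is a tensor network $G_D=(V_D,E_D,w)$ with a set $\bar E=\{e_1,\dots,e_N\}\subseteq E_D$ of edges to be sketched: each $e_j$ is uncontracted in $G_D$ and adjacent to exactly one tensor $v_j$, and the $v_j$ are distinct (some tensors may have no sketched edge). Let $s_j$ be the size of $e_j$. Let $R$ be the network of all data edges outside $\bar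 E$. Let $T_0$ be a contraction tree of $G_D$ with contractions $(U_i,V_i)$, $1\le i\le |V_D|-1$. Put $a_i=\exp(\mathrm{cut}_R(U_i)-\mathrm{cut}_R(U_i,V_i))$, $c_i=\exp(\mathrm{cut}_R(V_i)-\mathrm{cut}_R(U_i,V_i))$, $d_i=\exp(\mathrm{cut}_R(U_i\cup V_i))/(a_ic_i)$, $b_i=\exp(\mathrm{cut}_R(U_i,V_i))/d_i$. Let $\mathcal S$ be the set of those $i$ for which both $U_i$ and $V_i$ are adjacent to $\bar E$, $\mathcal D(e_j)$ the set of those $i$ for which $e_j$ is the only edge of $\bar E$ adjacent to $U_i\cup V_i$, and $\mathcal I$ the set of all other $i$. Let $X(e_j)=\{v_j\}\cup\bigcup_{i\in\mathcal D(e_j)}(U_i\cup V_i)$. An embedding $G_E=(V_E,E_E,w)$ with $N_E=|V_E|$ is a graph tensor network with $\bar E\subseteq E_E$. Each $e_j$ connects $v_j$ to one embedding tensor, exactly one further edge is uncontracted (the output edge, of size $m$), and every other edge connects two embedding tensors. Let $G=(G_D,G_E)$ be the overall network. A linearization is an ordering of the embedding tensors; all data tensors come before them, contracted embedding edges are directed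 to the later end, and the output edge is directed outward. This gives a directed acyclic graph $G_S$, and $\mathrm{cut}_{G_S}(A)$ is the total weight of the embedding edges leaving $A$. A contraction tree $T_B$ of $G$ is constrained on $T_0$ if for every contraction $(A,B)$ of $T_0$ there is a contraction $(\hat A,\hat B)$ of $T_B$ with $\hat A\cap V_D=A$ and $\hat B\cap V_D=B$ (contractions are unordered pairs). For positive constants $\kappa,\kappa_1,\kappa_2$ and $\epsilon>0$, $0<\delta<1$, put $K=N_E\log(1/\delta)/\epsilon^2$. The embedding is admissible if for some linearization $\exp(\mathrm{cut}_{G_S}(v))\ge\kappa K$ for all $v\in V_E$, and $\kappa_1K\le m\le\kappa_2K$. Let $t_j$ be the optimal cost of sketching the subnetwork $X(e_j)$ with one matrix of size $m\times s_j$ attached to $e_j$. That is, $t_j$ is the minimal cost of a contraction tree of $X(e_j)$ together with this matrix (edges of $G_D$ leaving $X(e_j)$ counting as uncontracted) that is constrained on the contractions of $T_0$ inside $X(e_j)$. Let $z_i=a_ib_ic_id_i\cdot\min(\exp(\mathrm{cut}_{G_S}(U_i\cup V_i)),m)$. **Theorem.** For all positive constants $\kappa,\kappa_1,\kappa_2$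 there is a constant $C>0$ such that the following holds for all $\epsilon>0$, $0<\delta<1$, all data networks $G_D$ with a contraction tree $T_0$, all admissible embeddings $G_E$ whose sketch size satisfies $m<s_j$ for every $j$, and all contraction trees $T_B$ of $(G_D,G_E)$ constrained on $T_0$. The cost of $T_B$ is at least $$C\Bigl(\sum_{j=1}^N t_j+\sum_{i\in\mathcal S}a_ib_ic_id_i\,m^2+N m^{2.5}+\sum_{i\in\mathcal I}z_i\Bigr)$$ if $N\ge 2$, and at least the same expression without the term $Nm^{2.5}$ if $N\le 1$. -/

import Mathlib

open Finset

/-- A tensor network, given as an undirected hypergraph on the vertex set `V` (the tensors) with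
hyperedges `E` (the dimensions).  `inc e` is the set of vertices adjacent to `e`, `dangling e` says
that `e` has a dangling end (it is uncontracted), and `size e` is the dimension size of `e`. Every
hyperedge has at least two ends, one of which may be the dangling one. Several hyperedges may be
adjacent to the same vertices. -/
structure TensorNetwork (V E : Type*) where
  inc : E → Finset V
  dangling : E → Bool
  size : E → ℕ
  size_pos : ∀ e, 0 < size e
  two_ends : ∀ e, 2 ≤ (inc e).card + (dangling e).toNat

namespace TensorNetwork

variable {V E : Type*} [Fintype V] [DecidableEq V] [Fintype E] [DecidableEq E]

/-- `w(e)`, the natural logarithm of the dimension size. -/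
noncomputable def weight (G : TensorNetwork V E) (e : E) : ℝ := Real.log (G.size e)

/-- `E(A, B)`: the hyperedges adjacent to both `A` and `B`. -/
def edgesBetween (G : TensorNetwork V E) (A B : Finset V) : Finset E :=
  univ.filter fun e => (∃ v ∈ G.inc e, v ∈ A) ∧ (∃ v ∈ G.inc e, v ∈ B)

/-- `E(A, *)`: the uncontracted hyperedges adjacent to `A` only. -/
def edgesDangling (G : TensorNetwork V E) (A : Finset V) : Finset E :=
  univ.filter fun e => G.dangling e = true ∧ G.inc e ⊆ A

/-- `E(A) = E(A, V \ A) ∪ E(A, *)`: the dimensions of the contraction output of `A`. -/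
def edgesOut (G : TensorNetwork V E) (A : Finset V) : Finset E :=
  G.edgesBetween A (univ \ A) ∪ G.edgesDangling A

/-- `cut_G(A, B)`. -/
noncomputable def cutBetween (G : TensorNetwork V E) (A B : Finset V) : ℝ :=
  ∑ e ∈ G.edgesBetween A B, G.weight e

/-- `cut_G(A)`. -/
noncomputable def cut (G : TensorNetwork V E) (A : Finset V) : ℝ :=
  ∑ e ∈ G.edgesOut A, G.weight e

/-- `cost_G(A, B) = cut_G(A) + cut_G(B) - cut_G(A, B)`: the logarithm of the cost of contracting
the contraction outputs of `A` and `B` with classical dense matrix multiplication. -/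
noncomputable def logCost (G : TensorNetwork V E) (A B : Finset V) : ℝ :=
  G.cut A + G.cut B - G.cutBetween A B

/-- The same vertices with only the hyperedges in `S`. -/
def restrict (G : TensorNetwork V E) (S : Finset E) : TensorNetwork V {e // e ∈ S} where
  inc e := G.inc e
  dangling e := G.dangling e
  size e := G.size e
  size_pos e := G.size_pos e
  two_ends e := G.two_ends e

end TensorNetwork

/-- Rooted binary trees with leaves labelled by `V`. -/
inductive ContractionTree (V : Type*) where
  | leaf (v : V) : ContractionTree V
  | node (l r : ContractionTree V) : ContractionTree V

namespace ContractionTree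

variable {V : Type*} [DecidableEq V]

/-- The set of vertices contracted by the tree. -/
def verts : ContractionTree V → Finset V
  | leaf v => {v}
  | node l r => l.verts ∪ r.verts

/-- The contractions `(W₁, W₂)` of the tree, one for each inner vertex. -/
def contractions : ContractionTree V → Finset (Finset V × Finset V)
  | leaf _ => ∅
  | node l r => insert (l.verts, r.verts) (l.contractions ∪ r.contractions)

/-- The two children of every inner vertex are disjoint, so no tensor is used twice. -/
def Proper : ContractionTree V → Prop
  | leaf _ => True
  | node l r => l.Proper ∧ r.Proper ∧ Disjoint l.verts r.verts

/-- `T` is a contraction tree of the tensors in `A`: each of them occurs at exactly one leaf. -/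
def IsTreeOf (T : ContractionTree V) (A : Finset V) : Prop := T.Proper ∧ T.verts = A

/-- The cost of a contraction tree: the sum of the costs of its contractions. -/
noncomputable def cost {E : Type*} [Fintype V] [Fintype E] [DecidableEq E]
    (T : ContractionTree V) (G : TensorNetwork V E) : ℝ :=
  ∑ p ∈ T.contractions, Real.exp (G.logCost p.1 p.2)

/-- Every contraction `(A, B)` among the contractions `C` of data tensors is matched by a
contraction of `T` whose two inputs meet the data vertices (the left summand) in `A` and `B`.
The two inputs of a contraction are unordered. -/
def RespectsContractions {VD VE : Type*} [DecidableEq VD] [DecidableEq VE]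
    (T : ContractionTree (VD ⊕ VE)) (C : Finset (Finset VD × Finset VD)) : Prop :=
  ∀ p ∈ C, ∃ q ∈ T.contractions,
    (q.1.toLeft = p.1 ∧ q.2.toLeft = p.2) ∨ (q.1.toLeft = p.2 ∧ q.2.toLeft = p.1)

/-- `T` is constrained on the data contraction tree `T₀`. -/
def ConstrainedOn {VD VE : Type*} [DecidableEq VD] [DecidableEq VE]
    (T : ContractionTree (VD ⊕ VE)) (T₀ : ContractionTree VD) : Prop :=
  T.RespectsContractions T₀.contractions

end ContractionTree

/-- A data tensor network with its set `sketched` of edges to be sketched. Each of these is an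
uncontracted edge of the data adjacent to exactly one tensor, `vertex e`, and each tensor is
adjacent to at most one of them. All other hyperedges are arbitrary. -/
structure DataNetwork (VD ED : Type*) extends TensorNetwork VD ED where
  sketched : Finset ED
  vertex : {e // e ∈ sketched} → VD
  vertex_injective : Function.Injective vertex
  inc_sketched : ∀ e : {e // e ∈ sketched}, inc e = {vertex e}
  dangling_sketched : ∀ e : {e // e ∈ sketched}, dangling e = true

namespace DataNetwork

variable {VD ED : Type*} [Fintype VD] [DecidableEq VD] [Fintype ED] [DecidableEq ED]

/-- The index type of the edges `e₁, …, e_N` to be sketched. -/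
abbrev Sketched (D : DataNetwork VD ED) : Type _ := {e // e ∈ D.sketched}

/-- The number `N` of edges to be sketched. -/
def order (D : DataNetwork VD ED) : ℕ := D.sketched.card

/-- The network `R` of the data edges that are not sketched. (Embedding vertices are isolated in
`R`, hence are left out.) -/
def rest (D : DataNetwork VD ED) : TensorNetwork VD {e // e ∈ univ \ D.sketched} :=
  D.toTensorNetwork.restrict (univ \ D.sketched)

/-- The edges to be sketched that are adjacent to `A`. -/
def sketchedAt (D : DataNetwork VD ED) (A : Finset VD) : Finset D.Sketched :=
  univ.filter fun e => D.vertex e ∈ A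

/-- `a = exp(cut_R(U) - cut_R(U, V))` for the contraction `p = (U, V)`. -/
noncomputable def aSize (D : DataNetwork VD ED) (p : Finset VD × Finset VD) : ℝ :=
  Real.exp (D.rest.cut p.1 - D.rest.cutBetween p.1 p.2)

/-- `c = exp(cut_R(V) - cut_R(U, V))`. -/
noncomputable def cSize (D : DataNetwork VD ED) (p : Finset VD × Finset VD) : ℝ :=
  Real.exp (D.rest.cut p.2 - D.rest.cutBetween p.1 p.2)

/-- `d = exp(cut_R(U ∪ V)) / (a c)`. -/
noncomputable def dSize (D : DataNetwork VD ED) (p : Finset VD × Finset VD) : ℝ :=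
  Real.exp (D.rest.cut (p.1 ∪ p.2)) / (D.aSize p * D.cSize p)

/-- `b = exp(cut_R(U, V)) / d`. -/
noncomputable def bSize (D : DataNetwork VD ED) (p : Finset VD × Finset VD) : ℝ :=
  Real.exp (D.rest.cutBetween p.1 p.2) / D.dSize p

/-- The class `𝒮`: contractions both of whose inputs are adjacent to edges to be sketched. -/
def classS (D : DataNetwork VD ED) (T₀ : ContractionTree VD) : Finset (Finset VD × Finset VD) :=
  T₀.contractions.filter fun p => (D.sketchedAt p.1).Nonempty ∧ (D.sketchedAt p.2).Nonempty

/-- The class `𝒟(e_j)`: contractions whose output is adjacent to the sketched edge `j` and to no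
other one. -/
def classD (D : DataNetwork VD ED) (T₀ : ContractionTree VD) (j : D.Sketched) :
    Finset (Finset VD × Finset VD) :=
  T₀.contractions.filter fun p => D.sketchedAt (p.1 ∪ p.2) = {j}

/-- The class `ℐ` of all remaining contractions. -/
def classI (D : DataNetwork VD ED) (T₀ : ContractionTree VD) : Finset (Finset VD × Finset VD) :=
  T₀.contractions.filter fun p => p ∉ D.classS T₀ ∧ ∀ j, p ∉ D.classD T₀ j

/-- `X(e_j)`: the tensors contracted by `𝒟(e_j)`, and just `v_j` if `𝒟(e_j)` is empty. -/
def subnet (D : DataNetwork VD ED) (T₀ : ContractionTree VD) (j : D.Sketched) : Finset VD :=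
  insert (D.vertex j) ((D.classD T₀ j).biUnion fun p => p.1 ∪ p.2)

/-- The data together with a single sketching matrix of size `m × s_j`, the vertex `inr ()`: its
column dimension is the sketched edge `j`, and its row dimension, of size `m`, is uncontracted. -/
def withMatrix (D : DataNetwork VD ED) (j : D.Sketched) (m : ℕ) (hm : 0 < m) :
    TensorNetwork (VD ⊕ Unit) (ED ⊕ Unit) where
  inc
    | Sum.inl e => (D.inc e).disjSum (if e = j.1 then {()} else ∅)
    | Sum.inr _ => {Sum.inr ()}
  dangling
    | Sum.inl e => D.dangling e && decide (e ≠ j.1)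
    | Sum.inr _ => true
  size
    | Sum.inl e => D.size e
    | Sum.inr _ => m
  size_pos := by
    rintro (e | e)
    · exact D.size_pos e
    · exact hm
  two_ends := by
    rintro (e | e)
    · by_cases h : e = j.1
      · subst h
        simp [D.inc_sketched j]
      · simpa [h] using D.two_ends e
    · simp

/-- `t_j`: the optimal cost of sketching the subnetwork `X(e_j)` with a sketching matrix of output
size `m` attached to `e_j`. The contraction trees of `X(e_j)` and the matrix are subject to the
same constraint as everywhere: they respect the contractions of `T₀` inside `X(e_j)`. Edges leaving
`X(e_j)` are uncontracted dimensions of the subnetwork. -/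
noncomputable def sketchCost (D : DataNetwork VD ED) (T₀ : ContractionTree VD) (j : D.Sketched)
    (m : ℕ) (hm : 0 < m) : ℝ :=
  sInf {x : ℝ | ∃ T : ContractionTree (VD ⊕ Unit),
    T.IsTreeOf ((D.subnet T₀ j).disjSum {()}) ∧
    T.RespectsContractions
      (T₀.contractions.filter fun p => p.1 ∪ p.2 ⊆ D.subnet T₀ j) ∧
    x = T.cost (D.withMatrix j m hm)}

end DataNetwork

/-- A graph tensor network embedding of the data `D` with embedding tensors `VE`. Its edges are
the sketched edges of `D`, each of which connects its data tensor to one embedding tensor; the inner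
edges `FE`, each of which connects two embedding tensors; and a single uncontracted edge, the output
sketch dimension, of size `m`. -/
structure Embedding {VD ED : Type*} (D : DataNetwork VD ED) (VE FE : Type*) where
  attach : {e // e ∈ D.sketched} → VE
  ends : FE → Finset VE
  ends_card : ∀ f, (ends f).card = 2
  innerSize : FE → ℕ
  innerSize_pos : ∀ f, 0 < innerSize f
  out : VE
  m : ℕ
  m_pos : 0 < m

namespace Embedding

variable {VD ED VE FE : Type*} [Fintype VD] [DecidableEq VD] [Fintype ED] [DecidableEq ED]
  [Fintype VE] [DecidableEq VE] [Fintype FE] [DecidableEq FE] {D : DataNetwork VD ED}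

/-- The overall network `G = (G_D, G_E)`. Its edges are the data edges (among them the sketched
edges), the inner edges `some f` of the embedding and the output edge `none`. -/
def network (S : Embedding D VE FE) : TensorNetwork (VD ⊕ VE) (ED ⊕ Option FE) where
  inc
    | Sum.inl e => (D.inc e).disjSum (if h : e ∈ D.sketched then {S.attach ⟨e, h⟩} else ∅)
    | Sum.inr (some f) => (∅ : Finset VD).disjSum (S.ends f)
    | Sum.inr none => {Sum.inr S.out}
  dangling
    | Sum.inl e => D.dangling e && decide (e ∉ D.sketched)
    | Sum.inr (some _) => false
    | Sum.inr none => true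
  size
    | Sum.inl e => D.size e
    | Sum.inr (some f) => S.innerSize f
    | Sum.inr none => S.m
  size_pos := by
    rintro (e | _ | f)
    · exact D.size_pos e
    · exact S.m_pos
    · exact S.innerSize_pos f
  two_ends := by
    rintro (e | _ | f)
    · by_cases h : e ∈ D.sketched
      · simp [h, D.inc_sketched ⟨e, h⟩]
      · simpa [h] using D.two_ends e
    · simp
    · simp [S.ends_card f]

/-- The edge set `E_E` of the embedding inside the overall network. -/
def edges (_S : Embedding D VE FE) : Finset (ED ⊕ Option FE) := D.sketched.disjSum univ

/-- The position of a vertex in the sketching linearization given by an ordering `σ` of the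
embedding vertices: all data vertices are ordered ahead of the embedding vertices. (No embedding
edge connects two data vertices, so that their relative order is immaterial.) -/
def position (σ : VE ≃ Fin (Fintype.card VE)) : VD ⊕ VE → ℕ
  | Sum.inl _ => 0
  | Sum.inr v => (σ v : ℕ) + 1

/-- The edges leaving `A` in the sketching linearization DAG `G_S`: the embedding edges directed
from a vertex in `A` to a later vertex outside of `A`, and the uncontracted ones adjacent to `A`. -/
def edgesOutLin (S : Embedding D VE FE) (σ : VE ≃ Fin (Fintype.card VE))
    (A : Finset (VD ⊕ VE)) : Finset (ED ⊕ Option FE) :=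
  S.edges.filter fun e =>
    (∃ u ∈ S.network.inc e, ∃ v ∈ S.network.inc e,
      u ∈ A ∧ v ∉ A ∧ position σ u < position σ v) ∨
    (S.network.dangling e = true ∧ S.network.inc e ⊆ A)

/-- `cut_{G_S}(A)`. For an embedding vertex `v`, `exp(cut_{G_S}({v}))` is the row size of the
matricization of the tensor at `v`. -/
noncomputable def cutLin (S : Embedding D VE FE) (σ : VE ≃ Fin (Fintype.card VE))
    (A : Finset (VD ⊕ VE)) : ℝ :=
  ∑ e ∈ S.edgesOutLin σ A, S.network.weight e

/-- The embedding is in the class `𝒢^(ε,δ)`, as witnessed by the linearization `σ`, with implied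
constants `κ` (row sizes are `Ω(N_E log(1/δ)/ε²)`) and `κ₁, κ₂` (the output sketch size is
`m = Θ(N_E log(1/δ)/ε²)`), where `N_E` is the number of embedding tensors. -/
def Admissible (S : Embedding D VE FE) (σ : VE ≃ Fin (Fintype.card VE))
    (κ κ₁ κ₂ ε δ : ℝ) : Prop :=
  (∀ v : VE, κ * (Fintype.card VE * Real.log (1 / δ) / ε ^ 2) ≤
    Real.exp (S.cutLin σ {Sum.inr v})) ∧
  κ₁ * (Fintype.card VE * Real.log (1 / δ) / ε ^ 2) ≤ S.m ∧
  S.m ≤ κ₂ * (Fintype.card VE * Real.log (1 / δ) / ε ^ 2)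

/-- `z = a b c d · min(exp(cut_{G_S}(U ∪ V)), m)` for the data contraction `p = (U, V)`. -/
noncomputable def zCost (S : Embedding D VE FE) (σ : VE ≃ Fin (Fintype.card VE))
    (p : Finset VD × Finset VD) : ℝ :=
  D.aSize p * D.bSize p * D.cSize p * D.dSize p *
    min (Real.exp (S.cutLin σ ((p.1 ∪ p.2).disjSum ∅))) S.m

end Embedding

/-! Direct the embedding edges by the linearization. A contraction `(A, B)` of `T_B` involves,
without overlap, the unsketched data edges at its two data parts, the embedding edges leaving `A`,
those leaving `B`, and those entering `A ∪ B` (`Embedding.le_logCost`). Write l = log m and γ = log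
min(1, κ/κ₂). Admissibility and m < s_j give outgoing weight at least γ + l to every embedding
tensor and every v_j (`le_outW_singleton`). The outgoing edges of the latest such vertex of a set
all leave the set, so the bound passes to every set containing one (`DirectedNetwork.le_outW`).

Each of the four terms is bounded separately by a multiple of the cost. For 𝒮, both inputs of the
matching contraction emit γ + l; for ℐ, one of them does, or the minimum in z_i is at most 1.

For t_j, climb in `T_B` from v_j to the first contraction with an embedding tensor, and attach the
matrix to the data reached there, or to X(e_j) if the climb has left it. Every contraction of the
resulting tree is dominated by one of `T_B` with an input whose data part is nonempty and inside
X(e_j) (`sketchCost_le`). The X(e_j) are disjoint, so each contraction is charged boundedly often.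

For N m^{2.5}, N - 1 merges join two sets that both contain some v_j. Such a merge need not be
expensive itself. Either its result emits more than 3l/2, and the next contraction with a set
emitting about l is expensive; or the input containing the latest vertex receives about l/2, and the
contraction that formed this input was expensive. The exponent is about 5l/2 in both cases, and a
potential function does the accounting (`DirectedNetwork.potential_le_cost`). -/

/-! ### Laminar structure of rooted binary trees. -/

namespace ContractionTree

variable {V : Type*} [DecidableEq V]

/-- The vertex sets of all subtrees. -/
def nodes : ContractionTree V → Finset (Finset V)
  | leaf v => {{v}}
  | node l r => insert (l.verts ∪ r.verts) (l.nodes ∪ r.nodes)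

theorem verts_nonempty (T : ContractionTree V) : T.verts.Nonempty := by
  induction T with
  | leaf v => simp [verts]
  | node l r hl hr => exact hl.mono subset_union_left

theorem verts_mem_nodes (T : ContractionTree V) : T.verts ∈ T.nodes := by
  cases T <;> simp [verts, nodes]

theorem subset_verts {T : ContractionTree V} {M : Finset V} (h : M ∈ T.nodes) : M ⊆ T.verts := by
  induction T with
  | leaf v => simp_all [verts, nodes]
  | node l r hl hr =>
    simp only [nodes, mem_insert, mem_union] at h
    rcases h with rfl | h | h
    · exact subset_rfl
    · exact (hl h).trans subset_union_left
    · exact (hr h).trans subset_union_right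

theorem nonempty_of_mem_nodes {T : ContractionTree V} {M : Finset V} (h : M ∈ T.nodes) :
    M.Nonempty := by
  induction T with
  | leaf v => simp_all [nodes]
  | node l r hl hr =>
    simp only [nodes, mem_insert, mem_union] at h
    rcases h with rfl | h | h
    · exact l.verts_nonempty.mono subset_union_left
    · exact hl h
    · exact hr h

theorem singleton_mem_nodes {T : ContractionTree V} {v : V} (h : v ∈ T.verts) : {v} ∈ T.nodes := by
  induction T with
  | leaf w => simp_all [nodes, verts]
  | node l r hl hr =>
    simp only [verts, mem_union] at h
    rcases h with h | h
    · simp [nodes, hl h]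
    · simp [nodes, hr h]

theorem mem_nodes_of_mem_contractions {T : ContractionTree V} {p : Finset V × Finset V}
    (h : p ∈ T.contractions) : p.1 ∈ T.nodes ∧ p.2 ∈ T.nodes ∧ p.1 ∪ p.2 ∈ T.nodes := by
  induction T with
  | leaf v => simp [contractions] at h
  | node l r hl hr =>
    simp only [contractions, mem_insert, mem_union] at h
    simp only [nodes, mem_insert, mem_union]
    rcases h with rfl | h | h
    · simp [verts_mem_nodes]
    · have := hl h; tauto
    · have := hr h; tauto

theorem eq_singleton_or_union {T : ContractionTree V} {M : Finset V} (h : M ∈ T.nodes) :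
    (∃ v, M = {v}) ∨ ∃ p ∈ T.contractions, M = p.1 ∪ p.2 := by
  induction T with
  | leaf v => exact Or.inl ⟨v, by simpa [nodes] using h⟩
  | node l r hl hr =>
    simp only [nodes, mem_insert, mem_union] at h
    simp only [contractions, mem_insert, mem_union]
    rcases h with rfl | h | h
    · exact Or.inr ⟨_, Or.inl rfl, rfl⟩
    · rcases hl h with h | ⟨p, hp, h⟩
      · exact Or.inl h
      · exact Or.inr ⟨p, by tauto, h⟩
    · rcases hr h with h | ⟨p, hp, h⟩
      · exact Or.inl h
      · exact Or.inr ⟨p, by tauto, h⟩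

theorem union_subset_verts {T : ContractionTree V} {p : Finset V × Finset V}
    (h : p ∈ T.contractions) : p.1 ∪ p.2 ⊆ T.verts :=
  subset_verts (mem_nodes_of_mem_contractions h).2.2

theorem fst_nonempty {T : ContractionTree V} {p : Finset V × Finset V}
    (h : p ∈ T.contractions) : p.1.Nonempty :=
  nonempty_of_mem_nodes (mem_nodes_of_mem_contractions h).1

theorem snd_nonempty {T : ContractionTree V} {p : Finset V × Finset V}
    (h : p ∈ T.contractions) : p.2.Nonempty :=
  nonempty_of_mem_nodes (mem_nodes_of_mem_contractions h).2.1

theorem exists_parent {T : ContractionTree V} {M : Finset V} (h : M ∈ T.nodes)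
    (hM : M ≠ T.verts) : ∃ p ∈ T.contractions, p.1 = M ∨ p.2 = M := by
  induction T with
  | leaf v => simp_all [nodes, verts]
  | node l r hl hr =>
    simp only [nodes, mem_insert, mem_union] at h
    simp only [contractions, mem_insert, mem_union]
    rcases h with rfl | h | h
    · exact absurd rfl hM
    · by_cases hl' : M = l.verts
      · exact ⟨_, Or.inl rfl, Or.inl hl'.symm⟩
      · obtain ⟨p, hp, h⟩ := hl h hl'
        exact ⟨p, by tauto, h⟩
    · by_cases hr' : M = r.verts
      · exact ⟨_, Or.inl rfl, Or.inr hr'.symm⟩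
      · obtain ⟨p, hp, h⟩ := hr h hr'
        exact ⟨p, by tauto, h⟩

theorem Proper.disjoint {T : ContractionTree V} (hT : T.Proper) {p : Finset V × Finset V}
    (h : p ∈ T.contractions) : Disjoint p.1 p.2 := by
  induction T with
  | leaf v => simp [contractions] at h
  | node l r hl hr =>
    simp only [contractions, mem_insert, mem_union] at h
    rcases h with rfl | h | h
    · exact hT.2.2
    · exact hl hT.1 h
    · exact hr hT.2.1 h

theorem Proper.laminar {T : ContractionTree V} (hT : T.Proper) {M N : Finset V}
    (hM : M ∈ T.nodes) (hN : N ∈ T.nodes) : M ⊆ N ∨ N ⊆ M ∨ Disjoint M N := by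
  induction T with
  | leaf v => simp_all [nodes]
  | node l r hl hr =>
    have hM' := subset_verts hM
    have hN' := subset_verts hN
    simp only [nodes, mem_insert, mem_union] at hM hN
    rcases hM with rfl | hM | hM
    · exact Or.inr (Or.inl hN')
    · rcases hN with rfl | hN | hN
      · exact Or.inl hM'
      · exact hl hT.1 hM hN
      · exact Or.inr (Or.inr (hT.2.2.mono (subset_verts hM) (subset_verts hN)))
    · rcases hN with rfl | hN | hN
      · exact Or.inl hM'
      · exact Or.inr (Or.inr (hT.2.2.symm.mono (subset_verts hM) (subset_verts hN)))
      · exact hr hT.2.1 hM hN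

/-- The position of a node relative to a contraction. -/
theorem Proper.node_cases {T : ContractionTree V} (hT : T.Proper) {p : Finset V × Finset V}
    (hp : p ∈ T.contractions) {M : Finset V} (hM : M ∈ T.nodes) :
    p.1 ∪ p.2 ⊆ M ∨ M ⊆ p.1 ∨ M ⊆ p.2 ∨ Disjoint M (p.1 ∪ p.2) := by
  induction T with
  | leaf v => simp [contractions] at hp
  | node l r hl hr =>
    have hp' := union_subset_verts hp
    simp only [nodes, contractions, mem_insert, mem_union] at hM hp
    rcases hM with rfl | hM | hM
    · exact Or.inl hp'
    · rcases hp with rfl | hp | hp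
      · exact Or.inr (Or.inl (subset_verts hM))
      · exact hl hT.1 hp hM
      · exact Or.inr (Or.inr (Or.inr (hT.2.2.mono (subset_verts hM) (union_subset_verts hp))))
    · rcases hp with rfl | hp | hp
      · exact Or.inr (Or.inr (Or.inl (subset_verts hM)))
      · exact Or.inr (Or.inr (Or.inr (hT.2.2.symm.mono (subset_verts hM) (union_subset_verts hp))))
      · exact hr hT.2.1 hp hM

theorem Proper.left_ssubset {l r : ContractionTree V} (hT : (node l r).Proper)
    {M : Finset V} (hM : M ⊆ l.verts) : ¬ l.verts ∪ r.verts ⊆ M := by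
  intro h
  obtain ⟨x, hx⟩ := r.verts_nonempty
  exact disjoint_left.1 hT.2.2 (hM (h (mem_union_right _ hx))) hx

theorem Proper.right_ssubset {l r : ContractionTree V} (hT : (node l r).Proper)
    {M : Finset V} (hM : M ⊆ r.verts) : ¬ l.verts ∪ r.verts ⊆ M := by
  intro h
  obtain ⟨x, hx⟩ := l.verts_nonempty
  exact disjoint_left.1 hT.2.2 hx (hM (h (mem_union_left _ hx)))

theorem Proper.not_subset_both {l r : ContractionTree V} (hT : (node l r).Proper)
    {M : Finset V} (hne : M.Nonempty) (hl : M ⊆ l.verts) (hr : M ⊆ r.verts) : False := by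
  obtain ⟨x, hx⟩ := hne
  exact disjoint_left.1 hT.2.2 (hl hx) (hr hx)

/-- Both children of a node are nonempty and disjoint, so a union inside one child is neither the
whole node nor inside the other child. This makes the matching of data contractions injective. -/
theorem Proper.contraction_ext {T : ContractionTree V} (hT : T.Proper) {p q : Finset V × Finset V}
    (hp : p ∈ T.contractions) (hq : q ∈ T.contractions) (h : p.1 ∪ p.2 = q.1 ∪ q.2) : p = q := by
  induction T with
  | leaf v => simp [contractions] at hp
  | node l r hl hr =>
    simp only [contractions, mem_insert, mem_union] at hp hq
    rcases hp with rfl | hp | hp <;> rcases hq with rfl | hq | hq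
    · rfl
    · exact absurd h.subset (hT.left_ssubset (union_subset_verts hq))
    · exact absurd h.subset (hT.right_ssubset (union_subset_verts hq))
    · exact absurd h.superset (hT.left_ssubset (union_subset_verts hp))
    · exact hl hT.1 hp hq
    · exact (hT.not_subset_both ((fst_nonempty hp).mono subset_union_left)
        (union_subset_verts hp) (h ▸ union_subset_verts hq)).elim
    · exact absurd h.superset (hT.right_ssubset (union_subset_verts hp))
    · exact (hT.not_subset_both ((fst_nonempty hp).mono subset_union_left)
        (h ▸ union_subset_verts hq) (union_subset_verts hp)).elim
    · exact hr hT.2.1 hp hq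

/-- The subtree at a node. -/
theorem Proper.exists_subtree {T : ContractionTree V} (hT : T.Proper) {M : Finset V}
    (hM : M ∈ T.nodes) : ∃ t : ContractionTree V, t.IsTreeOf M ∧
      t.contractions = T.contractions.filter (fun p => p.1 ∪ p.2 ⊆ M) ∧
      ∀ N ∈ T.nodes, N ⊆ M → N ∈ t.nodes := by
  induction T with
  | leaf v =>
    refine ⟨leaf v, ⟨trivial, ?_⟩, by simp [contractions], fun N hN _ => hN⟩
    simpa [nodes, verts, eq_comm] using hM
  | node l r hl hr =>
    have hM' := hM
    simp only [nodes, mem_insert, mem_union] at hM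
    rcases hM with rfl | hM | hM
    · refine ⟨node l r, ⟨hT, rfl⟩, ?_, fun N hN _ => hN⟩
      rw [filter_true_of_mem]
      exact fun p hp => union_subset_verts hp
    · obtain ⟨t, ht, hc, hn⟩ := hl hT.1 hM
      have hMl := subset_verts hM
      refine ⟨t, ht, ?_, ?_⟩
      · rw [hc, contractions, filter_insert, if_neg (hT.left_ssubset hMl), filter_union,
          filter_false_of_mem (s := r.contractions), union_empty]
        intro p hp hpM
        exact hT.not_subset_both ((fst_nonempty hp).mono subset_union_left) (hpM.trans hMl)
          (union_subset_verts hp)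
      · intro N hN hNM
        simp only [nodes, mem_insert, mem_union] at hN
        rcases hN with rfl | hN | hN
        · exact (hT.left_ssubset hMl hNM).elim
        · exact hn N hN hNM
        · exact (hT.not_subset_both (nonempty_of_mem_nodes hN) (hNM.trans hMl)
            (subset_verts hN)).elim
    · obtain ⟨t, ht, hc, hn⟩ := hr hT.2.1 hM
      have hMr := subset_verts hM
      refine ⟨t, ht, ?_, ?_⟩
      · rw [hc, contractions, filter_insert, if_neg (hT.right_ssubset hMr), filter_union,
          filter_false_of_mem (s := l.contractions), empty_union]
        intro p hp hpM
        exact hT.not_subset_both ((fst_nonempty hp).mono subset_union_left)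
          (union_subset_verts hp) (hpM.trans hMr)
      · intro N hN hNM
        simp only [nodes, mem_insert, mem_union] at hN
        rcases hN with rfl | hN | hN
        · exact (hT.right_ssubset hMr hNM).elim
        · exact (hT.not_subset_both (nonempty_of_mem_nodes hN) (subset_verts hN)
            (hNM.trans hMr)).elim
        · exact hn N hN hNM

theorem Proper.sum_contractions_node {l r : ContractionTree V} (hT : (node l r).Proper)
    (f : Finset V × Finset V → ℝ) :
    ∑ p ∈ (node l r).contractions, f p =
      f (l.verts, r.verts) + (∑ p ∈ l.contractions, f p + ∑ p ∈ r.contractions, f p) := by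
  rw [contractions, sum_insert, sum_union]
  · rw [disjoint_left]
    intro p hp hq
    exact hT.not_subset_both ((fst_nonempty hp).mono subset_union_left)
        (union_subset_verts hp) (union_subset_verts hq)
  · rw [mem_union]
    rintro (h | h)
    · exact hT.left_ssubset (union_subset_verts h) subset_rfl
    · exact hT.right_ssubset (union_subset_verts h) subset_rfl

end ContractionTree

/-! ### Directed networks and the potential argument for the exponent 5/2. -/

/-- A weighted acyclic network: every edge is directed from its source to a vertex in a later
position, or outward if it has no target. -/
structure DirectedNetwork (V ι : Type*) where
  edges : Finset ι
  src : ι → V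
  dst : ι → Option V
  weight : ι → ℝ
  weight_nonneg : ∀ e, 0 ≤ weight e
  pos : V → ℕ
  active : Finset V
  src_mem : ∀ e ∈ edges, src e ∈ active
  dst_mem : ∀ e ∈ edges, ∀ x ∈ dst e, x ∈ active
  pos_lt : ∀ e ∈ edges, ∀ x ∈ dst e, pos (src e) < pos x

namespace DirectedNetwork

variable {V ι : Type*}

theorem sum_mono {N : DirectedNetwork V ι} {s t : Finset ι} (h : s ⊆ t) : ∑ e ∈ s, N.weight e ≤ ∑ e ∈ t, N.weight e :=
  sum_le_sum_of_subset_of_nonneg h fun e _ _ => N.weight_nonneg e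

variable [DecidableEq V] (N : DirectedNetwork V ι)

open Classical in
/-- The edges with source in `A` and target outside of `C`. -/
noncomputable def leaving (A C : Finset V) : Finset ι :=
  N.edges.filter fun e => N.src e ∈ A ∧ ∀ x ∈ N.dst e, x ∉ C

open Classical in
/-- The edges with source outside of `A` and target in `A`. -/
noncomputable def entering (A : Finset V) : Finset ι :=
  N.edges.filter fun e => N.src e ∉ A ∧ ∃ x ∈ N.dst e, x ∈ A

/-- The total weight of the edges leaving `A`. -/
noncomputable def outW (A : Finset V) : ℝ := ∑ e ∈ N.leaving A A, N.weight e

/-- The total weight of the edges entering `A`. -/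
noncomputable def innW (A : Finset V) : ℝ := ∑ e ∈ N.entering A, N.weight e

variable {N}

theorem mem_leaving {A C : Finset V} {e : ι} :
    e ∈ N.leaving A C ↔ e ∈ N.edges ∧ N.src e ∈ A ∧ ∀ x ∈ N.dst e, x ∉ C := by
  simp [leaving]

theorem mem_entering {A : Finset V} {e : ι} :
    e ∈ N.entering A ↔ e ∈ N.edges ∧ N.src e ∉ A ∧ ∃ x ∈ N.dst e, x ∈ A := by
  simp [entering]

theorem outW_nonneg (A : Finset V) : 0 ≤ N.outW A := sum_nonneg fun e _ => N.weight_nonneg e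

theorem innW_nonneg (A : Finset V) : 0 ≤ N.innW A := sum_nonneg fun e _ => N.weight_nonneg e

/-- All ends of edges are active, so other vertices are invisible. In the application these are the
data tensors without a sketched edge. -/
theorem outW_congr {A B : Finset V} (h : A ∩ N.active = B ∩ N.active) : N.outW A = N.outW B := by
  have key : ∀ x ∈ N.active, (x ∈ A ↔ x ∈ B) := fun x hx => by
    have := Finset.ext_iff.1 h x
    simpa [hx] using this
  refine sum_congr ?_ fun _ _ => rfl
  ext e
  simp only [mem_leaving]
  refine and_congr_right fun he => and_congr (key _ (N.src_mem e he)) ?_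
  exact forall₂_congr fun x hx => not_congr (key _ (N.dst_mem e he x hx))

theorem innW_congr {A B : Finset V} (h : A ∩ N.active = B ∩ N.active) : N.innW A = N.innW B := by
  have key : ∀ x ∈ N.active, (x ∈ A ↔ x ∈ B) := fun x hx => by
    have := Finset.ext_iff.1 h x
    simpa [hx] using this
  refine sum_congr ?_ fun _ _ => rfl
  ext e
  simp only [mem_entering]
  refine and_congr_right fun he => and_congr (not_congr (key _ (N.src_mem e he))) ?_
  exact exists_congr fun x => and_congr_right fun hx => key _ (N.dst_mem e he x hx)

theorem outW_eq_zero {A : Finset V} (h : A ∩ N.active = ∅) : N.outW A = 0 := by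
  rw [outW_congr (B := ∅) (by simpa using h)]
  refine sum_eq_zero fun e he => ?_
  simp [mem_leaving] at he

/-- The edges of an active vertex in the latest position of `C` leave `C`. -/
theorem leaving_singleton_subset {A C : Finset V} {v : V} (hv : v ∈ A)
    (hmax : ∀ x ∈ C ∩ N.active, N.pos x ≤ N.pos v) : N.leaving {v} {v} ⊆ N.leaving A C := by
  intro e he
  rw [mem_leaving] at he ⊢
  obtain ⟨he, hs, -⟩ := he
  rw [mem_singleton] at hs
  refine ⟨he, hs ▸ hv, fun x hx hxC => ?_⟩
  have h1 := hmax x (mem_inter.2 ⟨hxC, N.dst_mem e he x hx⟩)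
  have h2 := N.pos_lt e he x hx
  rw [hs] at h2
  omega

theorem exists_last {C : Finset V} (h : (C ∩ N.active).Nonempty) :
    ∃ v ∈ C, v ∈ N.active ∧ ∀ x ∈ C ∩ N.active, N.pos x ≤ N.pos v := by
  obtain ⟨v, hv, hmax⟩ := exists_max_image _ N.pos h
  exact ⟨v, (mem_inter.1 hv).1, (mem_inter.1 hv).2, hmax⟩

theorem le_outW {a : ℝ} (ha : ∀ v ∈ N.active, a ≤ N.outW {v}) {A : Finset V}
    (h : (A ∩ N.active).Nonempty) : a ≤ N.outW A := by
  obtain ⟨v, hv, hva, hmax⟩ := exists_last h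
  exact (ha v hva).trans (sum_mono (leaving_singleton_subset hv hmax))

/-- An edge leaving `A` either leaves `A ∪ B` or enters `B`. The outgoing edges of the latest vertex
`v` leave `A ∪ B` too, and have their source in `B`, so they are not counted twice. -/
theorem two_mul_le_outW_union_add_innW {a : ℝ} {A B : Finset V} (hAB : Disjoint A B) {v : V}
    (hv : v ∈ B) (hmax : ∀ x ∈ (A ∪ B) ∩ N.active, N.pos x ≤ N.pos v) (hva : a ≤ N.outW {v})
    (hA : a ≤ N.outW A) : 2 * a ≤ N.outW (A ∪ B) + N.innW B := by
  classical
  have h1 : ∑ e ∈ N.leaving A (A ∪ B), N.weight e + ∑ e ∈ N.leaving B (A ∪ B), N.weight e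
      ≤ N.outW (A ∪ B) := by
    rw [← sum_union]
    · refine sum_mono fun e he => ?_
      simp only [mem_leaving, mem_union] at he ⊢
      tauto
    · rw [disjoint_left]
      intro e he he'
      exact disjoint_left.1 hAB (mem_leaving.1 he).2.1 (mem_leaving.1 he').2.1
  have h2 : a ≤ ∑ e ∈ N.leaving B (A ∪ B), N.weight e :=
    hva.trans (sum_mono (leaving_singleton_subset hv hmax))
  have h3 : N.outW A ≤ ∑ e ∈ N.leaving A (A ∪ B), N.weight e + N.innW B := by
    refine le_trans (sum_mono (t := N.leaving A (A ∪ B) ∪ N.entering B) fun e he => ?_) ?_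
    · rw [mem_leaving] at he
      rw [mem_union, mem_leaving, mem_entering]
      by_cases hB : ∃ x ∈ N.dst e, x ∈ B
      · exact Or.inr ⟨he.1, disjoint_left.1 hAB he.2.1, hB⟩
      · refine Or.inl ⟨he.1, he.2.1, fun x hx hxC => ?_⟩
        rcases mem_union.1 hxC with h | h
        · exact he.2.2 x hx h
        · exact hB ⟨x, hx, h⟩
    · have := sum_union_inter (s₁ := N.leaving A (A ∪ B)) (s₂ := N.entering B) (f := N.weight)
      have h0 : 0 ≤ ∑ e ∈ N.leaving A (A ∪ B) ∩ N.entering B, N.weight e :=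
        sum_nonneg fun e _ => N.weight_nonneg e
      rw [innW]
      linarith
  linarith

theorem add_outW_singleton_le {C : Finset V} {u v : V} (huv : u ≠ v) (hu : u ∈ C) (hv : v ∈ C)
    (hu0 : N.pos u = 0) (hv0 : N.pos v = 0) (hC : ∀ x ∈ C ∩ N.active, N.pos x = 0) :
    N.outW {u} + N.outW {v} ≤ N.outW C := by
  classical
  rw [outW, outW, ← sum_union]
  · exact sum_mono (union_subset
      (leaving_singleton_subset hu fun x hx => by rw [hC x hx]; omega)
      (leaving_singleton_subset hv fun x hx => by rw [hC x hx]; omega))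
  · rw [disjoint_left]
    intro e he he'
    have h1 := (mem_leaving.1 he).2.1
    have h2 := (mem_leaving.1 he').2.1
    rw [mem_singleton] at h1 h2
    exact huv (h1.symm.trans h2)

/-- The active vertices of `A` in position zero. -/
def sources (N : DirectedNetwork V ι) (A : Finset V) : Finset V :=
  (A ∩ N.active).filter fun v => N.pos v = 0

theorem sources_subset (A : Finset V) : N.sources A ⊆ A ∩ N.active := filter_subset _ _

theorem mem_sources {A : Finset V} {v : V} :
    v ∈ N.sources A ↔ v ∈ A ∧ v ∈ N.active ∧ N.pos v = 0 := by
  simp [sources, and_assoc]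

/-- Of the weight 2(γ + l) at most 3l/2 leaves `A ∪ B`, so the rest enters `B`. The latest vertex
`v` is not in position zero: otherwise no edge would run inside `A ∪ B`, and a source of `A` and one
of `B` together would emit more than 2l. Hence `v` and a source of `B` are two active vertices. -/
theorem exists_large_innW {γ l : ℝ} (hl : 0 ≤ l)
    (hact : ∀ v ∈ N.active, γ + l ≤ N.outW {v})
    (hsrc : ∀ v ∈ N.active, N.pos v = 0 → l < N.outW {v}) {A B : Finset V} (hAB : Disjoint A B)
    (hA : (N.sources A).Nonempty) (hB : (N.sources B).Nonempty) {v : V} (hv : v ∈ B)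
    (hva : v ∈ N.active) (hmax : ∀ x ∈ (A ∪ B) ∩ N.active, N.pos x ≤ N.pos v)
    (hout : N.outW (A ∪ B) ≤ 3 / 2 * l) :
    2 * γ + l / 2 ≤ N.innW B ∧ 2 ≤ (B ∩ N.active).card := by
  obtain ⟨u, hu⟩ := hA
  obtain ⟨w, hw⟩ := hB
  rw [mem_sources] at hu hw
  have h1 := two_mul_le_outW_union_add_innW hAB hv hmax (hact v hva)
    (le_outW hact ⟨u, mem_inter.2 ⟨hu.1, hu.2.1⟩⟩)
  refine ⟨by linarith, ?_⟩
  by_cases hv0 : N.pos v = 0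
  · exfalso
    have huw : u ≠ w := fun h => disjoint_left.1 hAB hu.1 (h ▸ hw.1)
    have := add_outW_singleton_le (C := A ∪ B) huw (mem_union_left _ hu.1) (mem_union_right _ hw.1)
      hu.2.2 hw.2.2 fun x hx => by have := hmax x hx; omega
    have h3 := hsrc u hu.2.1 hu.2.2
    have h4 := hsrc w hw.2.1 hw.2.2
    linarith
  · refine one_lt_card.2 ⟨v, mem_inter.2 ⟨hv, hva⟩, w, mem_inter.2 ⟨hw.1, hw.2.1⟩, ?_⟩
    rintro rfl
    exact hv0 hw.2.2

/-- One unit if the set has at least two active vertices and many edges enter it. -/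
noncomputable def credit (N : DirectedNetwork V ι) (b : ℝ) (A : Finset V) : ℝ :=
  if b ≤ N.innW A ∧ 2 ≤ (A ∩ N.active).card then 1 else 0

/-- One unit if many edges leave the set. -/
noncomputable def debit (N : DirectedNetwork V ι) (b : ℝ) (A : Finset V) : ℝ :=
  if b < N.outW A then 1 else 0

/-- The potential counts the merges of sources so far. A debit marks a merge still to be paid by the
next relevant contraction; a credit marks an expensive contraction held in reserve for a later
merge. Each expensive contraction pays at most three units: the debits of its two inputs and the
credit of its output. -/
theorem potential_le_cost {γ l : ℝ} (hγ : γ ≤ 0) (hl : 0 ≤ l)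
    (hact : ∀ v ∈ N.active, γ + l ≤ N.outW {v})
    (hsrc : ∀ v ∈ N.active, N.pos v = 0 → l < N.outW {v})
    (W : Finset V × Finset V → ℝ)
    (hW : ∀ A B, Disjoint A B → Real.exp (N.outW A + N.outW B + N.innW (A ∪ B)) ≤ W (A, B))
    (T : ContractionTree V) (hT : T.Proper) :
    Real.exp (4 * γ + 5 / 2 * l) * ((((N.sources T.verts).card - 1 : ℕ) : ℝ)
      + N.credit (2 * γ + l / 2) T.verts - N.debit (3 / 2 * l) T.verts)
      ≤ 3 * ∑ p ∈ T.contractions, W p := by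
  set μ := Real.exp (4 * γ + 5 / 2 * l) with hμ
  have hμ0 : 0 < μ := Real.exp_pos _
  have hnn : ∀ T : ContractionTree V, T.Proper → 0 ≤ ∑ p ∈ T.contractions, W p := fun T hT =>
    sum_nonneg fun p hp => (Real.exp_pos _).le.trans (hW p.1 p.2 (hT.disjoint hp))
  induction T with
  | leaf v =>
    have h1 : (N.sources (ContractionTree.leaf v).verts).card - 1 = 0 := by
      have := card_le_card (N.sources_subset {v})
      have h2 := card_le_card (inter_subset_left (s₁ := {v}) (s₂ := N.active))
      simp only [ContractionTree.verts, card_singleton] at *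
      omega
    -- A leaf may receive much weight, but no contraction has paid for it; asking for two active
    -- vertices excludes it.
    have h2 : N.credit (2 * γ + l / 2) (ContractionTree.leaf v).verts = 0 := by
      rw [credit, if_neg]
      rintro ⟨-, h⟩
      have h2 := card_le_card (inter_subset_left (s₁ := {v}) (s₂ := N.active))
      simp only [ContractionTree.verts, card_singleton] at *
      omega
    have h3 : 0 ≤ N.debit (3 / 2 * l) (ContractionTree.leaf v).verts := by
      rw [debit]; split_ifs <;> norm_num
    rw [h1, h2]
    simp only [ContractionTree.contractions, sum_empty, mul_zero]
    have := mul_nonneg hμ0.le h3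
    push_cast
    linarith
  | node L R ihL ihR =>
    rw [hT.sum_contractions_node]
    have hL := ihL hT.1
    have hR := ihR hT.2.1
    have hdis := hT.2.2
    have htop := hW _ _ hdis
    have htop0 := (Real.exp_pos _).le.trans htop
    simp only [ContractionTree.verts]
    generalize L.verts = A at *
    generalize R.verts = B at *
    -- If one input has no active vertices, the union has the potential of the other input.
    by_cases hA : (A ∩ N.active).Nonempty
    swap
    · rw [not_nonempty_iff_eq_empty] at hA
      have hAB : (A ∪ B) ∩ N.active = B ∩ N.active := by
        rw [union_inter_distrib_right, hA, empty_union]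
      have hL' := hnn L hT.1
      simp only [credit, debit, sources, hAB, outW_congr hAB, innW_congr hAB] at hR ⊢
      linarith
    by_cases hB : (B ∩ N.active).Nonempty
    swap
    · rw [not_nonempty_iff_eq_empty] at hB
      have hAB : (A ∪ B) ∩ N.active = A ∩ N.active := by
        rw [union_inter_distrib_right, hB, union_empty]
      have hR' := hnn R hT.2.1
      simp only [credit, debit, sources, hAB, outW_congr hAB, innW_congr hAB] at hL ⊢
      linarith
    have hoA := le_outW hact hA
    have hoB := le_outW hact hB
    have hiAB := N.innW_nonneg (A ∪ B)
    have big : ∀ x : ℝ, 4 * γ + 5 / 2 * l ≤ x → x ≤ N.outW A + N.outW B + N.innW (A ∪ B) →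
        μ ≤ W (A, B) := fun x h1 h2 => (Real.exp_le_exp.2 (h1.trans h2)).trans htop
    -- Here `t` indicates an expensive contraction. A debit of an input forces exponent 3l/2 + (γ +
    -- l), and a credit of the union forces 2(γ + l) + (2γ + l/2) = 4γ + 5l/2, which is where `μ`
    -- comes from.
    obtain ⟨t, ht0, ht1, htW, hdA, hdB, hcAB⟩ : ∃ t : ℝ, 0 ≤ t ∧ t ≤ 1 ∧ μ * t ≤ W (A, B) ∧
        N.debit (3 / 2 * l) A ≤ t ∧ N.debit (3 / 2 * l) B ≤ t ∧
        N.credit (2 * γ + l / 2) (A ∪ B) ≤ t := by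
      by_cases hbig : μ ≤ W (A, B)
      · refine ⟨1, zero_le_one, le_rfl, by simpa using hbig, ?_, ?_, ?_⟩ <;>
          simp only [debit, credit] <;> split_ifs <;> norm_num
      · refine ⟨0, le_rfl, zero_le_one, by simpa using htop0, ?_, ?_, ?_⟩
        · rw [debit, if_neg]
          exact fun h => hbig (big (3 / 2 * l + (γ + l)) (by linarith) (by linarith))
        · rw [debit, if_neg]
          exact fun h => hbig (big (3 / 2 * l + (γ + l)) (by linarith) (by linarith))
        · rw [credit, if_neg]
          rintro ⟨h, -⟩
          exact hbig (big (2 * (γ + l) + (2 * γ + l / 2)) (by linarith) (by linarith))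
    have hcA : 0 ≤ N.credit (2 * γ + l / 2) A := by rw [credit]; split_ifs <;> norm_num
    have hcB : 0 ≤ N.credit (2 * γ + l / 2) B := by rw [credit]; split_ifs <;> norm_num
    have hd : 0 ≤ N.debit (3 / 2 * l) (A ∪ B) := by rw [debit]; split_ifs <;> norm_num
    have hcard : (N.sources (A ∪ B)).card = (N.sources A).card + (N.sources B).card := by
      rw [sources, union_inter_distrib_right, filter_union, card_union_of_disjoint]
      · rfl
      · exact hdis.mono ((N.sources_subset A).trans inter_subset_left)
          ((N.sources_subset B).trans inter_subset_left)
    -- With truncated subtraction the merge count grows only if both inputs contain sources. Then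
    -- the union takes a debit, or the input with the latest vertex hands over its credit.
    have hn : (((N.sources (A ∪ B)).card - 1 : ℕ) : ℝ) ≤ ((N.sources A).card - 1 : ℕ)
        + ((N.sources B).card - 1 : ℕ) + N.debit (3 / 2 * l) (A ∪ B)
        + N.credit (2 * γ + l / 2) A + N.credit (2 * γ + l / 2) B := by
      by_cases hsplit : (N.sources A).Nonempty ∧ (N.sources B).Nonempty
      · have h1 : (((N.sources (A ∪ B)).card - 1 : ℕ) : ℝ) = ((N.sources A).card - 1 : ℕ)
            + ((N.sources B).card - 1 : ℕ) + 1 := by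
          have hA1 := hsplit.1.card_pos
          have hB1 := hsplit.2.card_pos
          rw [hcard]
          norm_cast
          omega
        have h2 : 1 ≤ N.debit (3 / 2 * l) (A ∪ B) + N.credit (2 * γ + l / 2) A
            + N.credit (2 * γ + l / 2) B := by
          by_cases hout : 3 / 2 * l < N.outW (A ∪ B)
          · rw [debit, if_pos hout]
            linarith
          · rw [not_lt] at hout
            obtain ⟨v, hv, hva, hmax⟩ := exists_last (N := N) (C := A ∪ B)
              (hA.mono (inter_subset_inter_right subset_union_left))
            rcases mem_union.1 hv with hv | hv
            · have := exists_large_innW hl hact hsrc hdis.symm hsplit.2 hsplit.1 hv hva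
                (by rwa [union_comm]) (by rwa [union_comm])
              rw [show N.credit (2 * γ + l / 2) A = 1 from if_pos this]
              linarith
            · have := exists_large_innW hl hact hsrc hdis hsplit.1 hsplit.2 hv hva hmax hout
              rw [show N.credit (2 * γ + l / 2) B = 1 from if_pos this]
              linarith
        linarith
      · have h1 : (((N.sources (A ∪ B)).card - 1 : ℕ) : ℝ) ≤ ((N.sources A).card - 1 : ℕ)
            + ((N.sources B).card - 1 : ℕ) := by
          rw [hcard]
          norm_cast
          rw [not_and_or, not_nonempty_iff_eq_empty, not_nonempty_iff_eq_empty] at hsplit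
          rcases hsplit with h | h <;> simp [h]
        linarith
    have hμt : μ * ((((N.sources (A ∪ B)).card - 1 : ℕ) : ℝ) + N.credit (2 * γ + l / 2) (A ∪ B)
        - N.debit (3 / 2 * l) (A ∪ B)) ≤ μ * ((((N.sources A).card - 1 : ℕ) : ℝ)
        + N.credit (2 * γ + l / 2) A - N.debit (3 / 2 * l) A + ((((N.sources B).card - 1 : ℕ) : ℝ)
        + N.credit (2 * γ + l / 2) B - N.debit (3 / 2 * l) B) + 3 * t) :=
      mul_le_mul_of_nonneg_left (by linarith) hμ0.le
    linarith

end DirectedNetwork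

/-! ### Cost exponents as sums over edges. -/

namespace TensorNetwork

variable {V E : Type*} [Fintype V] [DecidableEq V] [Fintype E] [DecidableEq E]
  (G : TensorNetwork V E)

omit [Fintype V] [DecidableEq V] [Fintype E] [DecidableEq E] in
theorem inc_nonempty (e : E) : (G.inc e).Nonempty := by
  rw [← card_pos]
  have h := G.two_ends e
  have := Bool.toNat_le (G.dangling e)
  omega

omit [Fintype V] [DecidableEq V] [Fintype E] [DecidableEq E] in
theorem weight_nonneg (e : E) : 0 ≤ G.weight e :=
  Real.log_nonneg (by exact_mod_cast G.size_pos e)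

variable {G}

theorem sum_weight_mono {s t : Finset E} (h : s ⊆ t) :
    ∑ e ∈ s, G.weight e ≤ ∑ e ∈ t, G.weight e :=
  sum_le_sum_of_subset_of_nonneg h fun e _ _ => G.weight_nonneg e

theorem mem_edgesOut {A : Finset V} {e : E} : e ∈ G.edgesOut A ↔
    (∃ v ∈ G.inc e, v ∈ A) ∧ (G.dangling e = true ∨ ∃ v ∈ G.inc e, v ∉ A) := by
  simp only [edgesOut, edgesBetween, edgesDangling, mem_union, mem_filter, mem_univ, true_and,
    mem_sdiff]
  obtain ⟨v, hv⟩ := G.inc_nonempty e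
  constructor
  · rintro (⟨h, h'⟩ | ⟨h, h'⟩)
    · exact ⟨h, Or.inr h'⟩
    · exact ⟨⟨v, hv, h' hv⟩, Or.inl h⟩
  · rintro ⟨h, h' | h'⟩
    · by_cases hA : G.inc e ⊆ A
      · exact Or.inr ⟨h', hA⟩
      · exact Or.inl ⟨h, not_subset.1 hA⟩
    · exact Or.inl ⟨h, h'⟩

/-- An edge meeting two disjoint sets has an end outside each, so it is an output dimension of both.
The cost exponent thus becomes an inclusion-exclusion formula. -/
theorem edgesBetween_eq_inter {A B : Finset V} (h : Disjoint A B) :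
    G.edgesBetween A B = G.edgesOut A ∩ G.edgesOut B := by
  ext e
  simp only [mem_inter, edgesBetween, mem_filter, mem_univ, true_and]
  constructor
  · rintro ⟨⟨v, hv, hvA⟩, ⟨w, hw, hwB⟩⟩
    exact ⟨mem_edgesOut.2 ⟨⟨v, hv, hvA⟩, Or.inr ⟨w, hw, disjoint_right.1 h hwB⟩⟩,
      mem_edgesOut.2 ⟨⟨w, hw, hwB⟩, Or.inr ⟨v, hv, disjoint_left.1 h hvA⟩⟩⟩
  · rintro ⟨h1, h2⟩
    exact ⟨(mem_edgesOut.1 h1).1, (mem_edgesOut.1 h2).1⟩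

/-- The cost exponent of a contraction is the total weight of the dimensions involved. -/
theorem logCost_eq_sum {A B : Finset V} (h : Disjoint A B) :
    G.logCost A B = ∑ e ∈ G.edgesOut A ∪ G.edgesOut B, G.weight e := by
  have := sum_union_inter (s₁ := G.edgesOut A) (s₂ := G.edgesOut B) (f := G.weight)
  rw [logCost, cut, cut, cutBetween, edgesBetween_eq_inter h]
  linarith

theorem cut_le_logCost {A B : Finset V} (h : Disjoint A B) : G.cut A ≤ G.logCost A B := by
  rw [logCost_eq_sum h]
  exact sum_weight_mono subset_union_left

theorem edgesOut_empty : G.edgesOut ∅ = ∅ := by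
  ext e
  simp [mem_edgesOut]

theorem logCost_empty (A : Finset V) : G.logCost A ∅ = G.cut A := by
  rw [logCost_eq_sum (disjoint_empty_right A), edgesOut_empty, union_empty, cut]

theorem logCost_comm {A B : Finset V} : G.logCost A B = G.logCost B A := by
  have : G.edgesBetween A B = G.edgesBetween B A := by
    ext e
    simp [edgesBetween, and_comm]
  rw [logCost, logCost, cutBetween, cutBetween, this]
  ring

end TensorNetwork

namespace DataNetwork

variable {VD ED : Type*} [Fintype VD] [DecidableEq VD] [Fintype ED] [DecidableEq ED]
  (D : DataNetwork VD ED)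

/-- The edges outside of the sketched ones that are involved in a contraction. -/
def restEdges (A B : Finset VD) : Finset ED :=
  (D.toTensorNetwork.edgesOut A ∪ D.toTensorNetwork.edgesOut B) \ D.sketched

theorem rest_logCost_eq {A B : Finset VD} (h : Disjoint A B) :
    D.rest.logCost A B = ∑ e ∈ D.restEdges A B, D.weight e := by
  rw [TensorNetwork.logCost_eq_sum h]
  refine sum_bij (fun e _ => e.1) ?_ ?_ ?_ ?_
  · intro e he
    have h2 := e.2
    simp only [mem_sdiff, mem_univ, true_and] at h2
    simp only [restEdges, mem_sdiff, mem_union, TensorNetwork.mem_edgesOut] at he ⊢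
    exact ⟨he, h2⟩
  · intro a _ b _ hab
    exact Subtype.ext hab
  · intro e he
    simp only [restEdges, mem_sdiff, mem_union, TensorNetwork.mem_edgesOut] at he
    refine ⟨⟨e, by simp [he.2]⟩, ?_, rfl⟩
    simp only [mem_union, TensorNetwork.mem_edgesOut]
    exact he.1
  · intro e _
    rfl

/-- The factor d cancels against the denominator of b, leaving the three cuts of the cost exponent
in R. -/
theorem abcd_eq (p : Finset VD × Finset VD) :
    D.aSize p * D.bSize p * D.cSize p * D.dSize p = Real.exp (D.rest.logCost p.1 p.2) := by
  have hd : D.dSize p ≠ 0 := by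
    unfold dSize aSize cSize
    positivity
  have h : D.bSize p * D.dSize p = Real.exp (D.rest.cutBetween p.1 p.2) := by
    rw [bSize, div_mul_cancel₀ _ hd]
  calc _ = D.aSize p * D.cSize p * (D.bSize p * D.dSize p) := by ring
    _ = _ := by
      rw [h, aSize, cSize, ← Real.exp_add, ← Real.exp_add, TensorNetwork.logCost]
      congr 1
      ring

variable {D}

omit [Fintype VD] [Fintype ED] [DecidableEq ED] in
theorem mem_sketchedAt {A : Finset VD} {j : D.Sketched} : j ∈ D.sketchedAt A ↔ D.vertex j ∈ A := by
  simp [sketchedAt]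

theorem sketchedAt_union (A B : Finset VD) :
    D.sketchedAt (A ∪ B) = D.sketchedAt A ∪ D.sketchedAt B := by
  ext j
  simp [mem_sketchedAt]

end DataNetwork

/-! ### The embedding as a directed network inside the overall network. -/

namespace Embedding

variable {VD ED VE FE : Type*} [Fintype VD] [DecidableEq VD] [Fintype ED] [DecidableEq ED]
  [Fintype VE] [DecidableEq VE] [Fintype FE] [DecidableEq FE] {D : DataNetwork VD ED}
  (S : Embedding D VE FE) (σ : VE ≃ Fin (Fintype.card VE))

omit [Fintype VD] [Fintype ED] [DecidableEq FE] in
/-- Each embedding edge has a source, and a target in a later position unless it is the output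
edge. -/
theorem exists_orientation (e : ED ⊕ Option FE) (he : e ∈ S.edges) :
    ∃ q : (VD ⊕ VE) × Option (VD ⊕ VE), (∀ x, x ∈ S.network.inc e ↔ x = q.1 ∨ x ∈ q.2) ∧
      (S.network.dangling e = true ↔ q.2 = none) ∧
      ∀ x ∈ q.2, (position σ q.1 : ℕ) < position σ x := by
  rcases e with e | _ | f
  · have h : e ∈ D.sketched := by simpa [edges] using he
    refine ⟨(Sum.inl (D.vertex ⟨e, h⟩), some (Sum.inr (S.attach ⟨e, h⟩))), ?_, ?_, ?_⟩
    · have := D.inc_sketched ⟨e, h⟩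
      simp only at this
      rintro (x | x) <;> simp [network, h, this, eq_comm]
    · simp [network, h]
    · simp [position]
  · refine ⟨(Sum.inr S.out, none), ?_, ?_, ?_⟩
    · simp [network]
    · simp [network]
    · simp
  · obtain ⟨x, y, hxy, hf⟩ := card_eq_two.1 (S.ends_card f)
    have hσ : (σ x : ℕ) ≠ σ y := fun h => hxy (σ.injective (Fin.ext h))
    rcases lt_or_gt_of_ne hσ with h | h
    · refine ⟨(Sum.inr x, some (Sum.inr y)), ?_, ?_, ?_⟩
      · rintro (z | z) <;> simp [network, hf, eq_comm]
      · simp [network]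
      · simpa [position] using h
    · refine ⟨(Sum.inr y, some (Sum.inr x)), ?_, ?_, ?_⟩
      · rintro (z | z) <;> simp [network, hf, eq_comm, or_comm]
      · simp [network]
      · simpa [position] using h

/-- The embedding in the overall network, directed by a linearization. -/
theorem exists_directedNetwork : ∃ N : DirectedNetwork (VD ⊕ VE) (ED ⊕ Option FE),
    N.edges = S.edges ∧ N.weight = S.network.weight ∧ N.pos = position σ ∧
    N.active = univ.filter (fun x => ∀ v, x = Sum.inl v → ∃ j, D.vertex j = v) ∧
    (∀ e ∈ S.edges, ∀ x, x ∈ S.network.inc e ↔ x = N.src e ∨ x ∈ N.dst e) ∧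
    (∀ e ∈ S.edges, S.network.dangling e = true ↔ N.dst e = none) := by
  classical
  have : ∀ e : ED ⊕ Option FE, ∃ q : (VD ⊕ VE) × Option (VD ⊕ VE), e ∈ S.edges →
      (∀ x, x ∈ S.network.inc e ↔ x = q.1 ∨ x ∈ q.2) ∧
      (S.network.dangling e = true ↔ q.2 = none) ∧
      ∀ x ∈ q.2, (position σ q.1 : ℕ) < position σ x := by
    intro e
    by_cases he : e ∈ S.edges
    · obtain ⟨q, hq⟩ := S.exists_orientation σ e he
      exact ⟨q, fun _ => hq⟩
    · exact ⟨(Sum.inr S.out, none), fun h => absurd h he⟩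
  choose q hq using this
  have hact : ∀ e ∈ S.edges, ∀ x ∈ S.network.inc e,
      x ∈ univ.filter (fun x : VD ⊕ VE => ∀ v, x = Sum.inl v → ∃ j, D.vertex j = v) := by
    intro e he x hx
    rw [mem_filter]
    refine ⟨mem_univ _, ?_⟩
    rintro v rfl
    rcases e with e | _ | f
    · have h : e ∈ D.sketched := by simpa [edges] using he
      have := D.inc_sketched ⟨e, h⟩
      simp only at this
      simp [network, h, this] at hx
      exact ⟨_, hx.symm⟩
    · simp [network] at hx
    · simp [network] at hx
  exact ⟨{  edges := S.edges
            src := fun e => (q e).1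
            dst := fun e => (q e).2
            weight := S.network.weight
            weight_nonneg := S.network.weight_nonneg
            pos := position σ
            active := univ.filter (fun x => ∀ v, x = Sum.inl v → ∃ j, D.vertex j = v)
            src_mem := fun e he => hact e he _ (((hq e he).1 _).2 (Or.inl rfl))
            dst_mem := fun e he x hx => hact e he _ (((hq e he).1 _).2 (Or.inr hx))
            pos_lt := fun e he => (hq e he).2.2 }, rfl, rfl, rfl, rfl,
          fun e he => (hq e he).1, fun e he => (hq e he).2.1⟩

end Embedding

namespace Embedding

variable {VD ED VE FE : Type*} [Fintype VD] [DecidableEq VD] [Fintype ED] [DecidableEq ED]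
  [Fintype VE] [DecidableEq VE] [Fintype FE] [DecidableEq FE] {D : DataNetwork VD ED}
  (S : Embedding D VE FE) (σ : VE ≃ Fin (Fintype.card VE))

/-- The embedding in the overall network, directed by a linearization. -/
noncomputable def directed : DirectedNetwork (VD ⊕ VE) (ED ⊕ Option FE) :=
  (S.exists_directedNetwork σ).choose

theorem directed_edges : (S.directed σ).edges = S.edges :=
  (S.exists_directedNetwork σ).choose_spec.1

theorem directed_weight : (S.directed σ).weight = S.network.weight :=
  (S.exists_directedNetwork σ).choose_spec.2.1

theorem directed_pos : (S.directed σ).pos = position σ :=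
  (S.exists_directedNetwork σ).choose_spec.2.2.1

theorem mem_directed_active {x : VD ⊕ VE} :
    x ∈ (S.directed σ).active ↔ ∀ v, x = Sum.inl v → ∃ j, D.vertex j = v := by
  rw [directed, (S.exists_directedNetwork σ).choose_spec.2.2.2.1]
  simp

variable {S σ}

theorem mem_inc_iff {e : ED ⊕ Option FE} (he : e ∈ S.edges) {x : VD ⊕ VE} :
    x ∈ S.network.inc e ↔ x = (S.directed σ).src e ∨ x ∈ (S.directed σ).dst e :=
  (S.exists_directedNetwork σ).choose_spec.2.2.2.2.1 e he x

theorem dangling_iff {e : ED ⊕ Option FE} (he : e ∈ S.edges) :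
    S.network.dangling e = true ↔ (S.directed σ).dst e = none :=
  (S.exists_directedNetwork σ).choose_spec.2.2.2.2.2 e he

theorem inl_mem_active {v : VD} :
    Sum.inl v ∈ (S.directed σ).active ↔ ∃ j, D.vertex j = v := by
  simp [mem_directed_active]

theorem inr_mem_active (w : VE) : Sum.inr w ∈ (S.directed σ).active := by
  simp [mem_directed_active]

theorem pos_dst {e : ED ⊕ Option FE} (he : e ∈ S.edges) {x : VD ⊕ VE}
    (hx : x ∈ (S.directed σ).dst e) : position σ ((S.directed σ).src e) < position σ x := by
  have := (S.directed σ).pos_lt e (by rwa [directed_edges]) x hx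
  rwa [directed_pos] at this

theorem edgesOutLin_eq (A : Finset (VD ⊕ VE)) :
    S.edgesOutLin σ A = (S.directed σ).leaving A A := by
  ext e
  rw [edgesOutLin, mem_filter, DirectedNetwork.mem_leaving, directed_edges]
  refine and_congr_right fun he => ?_
  simp only [mem_inc_iff he (σ := σ), dangling_iff he (σ := σ)]
  constructor
  · rintro (⟨u, hu, v, hv, huA, hvA, huv⟩ | ⟨h, h'⟩)
    · rcases hu with rfl | hu
      · rcases hv with rfl | hv
        · exact absurd huA hvA
        · refine ⟨huA, fun x hx => ?_⟩
          obtain rfl := Option.mem_unique hx hv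
          exact hvA
      · have h1 := pos_dst he hu
        rcases hv with rfl | hv
        · omega
        · obtain rfl := Option.mem_unique hu hv
          omega
    · refine ⟨h' ((mem_inc_iff he).2 (Or.inl rfl)), by simp [h]⟩
  · rintro ⟨h1, h2⟩
    rcases hd : (S.directed σ).dst e with _ | x
    · refine Or.inr ⟨rfl, fun y hy => ?_⟩
      rw [mem_inc_iff he (σ := σ), hd] at hy
      rcases hy with rfl | hy
      · exact h1
      · simp at hy
    · have hx : x ∈ (S.directed σ).dst e := hd
      exact Or.inl ⟨_, Or.inl rfl, x, Or.inr rfl, h1, h2 x hx, pos_dst he hx⟩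

theorem cutLin_eq (A : Finset (VD ⊕ VE)) : S.cutLin σ A = (S.directed σ).outW A := by
  rw [cutLin, edgesOutLin_eq, DirectedNetwork.outW, directed_weight]

theorem leaving_subset_edgesOut (A : Finset (VD ⊕ VE)) :
    (S.directed σ).leaving A A ⊆ S.network.edgesOut A := by
  intro e he
  rw [DirectedNetwork.mem_leaving, directed_edges] at he
  obtain ⟨he, h1, h2⟩ := he
  rw [TensorNetwork.mem_edgesOut, dangling_iff he (σ := σ)]
  refine ⟨⟨_, (mem_inc_iff he).2 (Or.inl rfl), h1⟩, ?_⟩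
  rcases hd : (S.directed σ).dst e with _ | x
  · exact Or.inl rfl
  · exact Or.inr ⟨x, (mem_inc_iff he).2 (Or.inr hd), h2 x hd⟩

theorem entering_subset_edgesOut (A B : Finset (VD ⊕ VE)) :
    (S.directed σ).entering (A ∪ B) ⊆ S.network.edgesOut A ∪ S.network.edgesOut B := by
  intro e he
  rw [DirectedNetwork.mem_entering, directed_edges] at he
  obtain ⟨he, h1, x, hx, hxA⟩ := he
  have h3 := (mem_inc_iff he (σ := σ)).2 (Or.inl rfl)
  have h4 := (mem_inc_iff he).2 (Or.inr hx)
  simp only [mem_union, not_or, TensorNetwork.mem_edgesOut] at h1 hxA ⊢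
  rcases hxA with h | h
  · exact Or.inl ⟨⟨x, h4, h⟩, Or.inr ⟨_, h3, h1.1⟩⟩
  · exact Or.inr ⟨⟨x, h4, h⟩, Or.inr ⟨_, h3, h1.2⟩⟩

theorem inl_mem_edgesOut {A : Finset (VD ⊕ VE)} {e : ED} (he : e ∉ D.sketched) :
    Sum.inl e ∈ S.network.edgesOut A ↔ e ∈ D.toTensorNetwork.edgesOut A.toLeft := by
  simp [TensorNetwork.mem_edgesOut, network, he]

/-- Lower bound for the cost of a contraction in terms of the data edges that are not sketched
and of the directed embedding edges. -/
theorem le_logCost {A B : Finset (VD ⊕ VE)} (h : Disjoint A B) :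
    D.rest.logCost A.toLeft B.toLeft + ((S.directed σ).outW A + (S.directed σ).outW B
      + (S.directed σ).innW (A ∪ B)) ≤ S.network.logCost A B := by
  have hl : Disjoint A.toLeft B.toLeft := by
    rw [disjoint_left] at h ⊢
    intro x hx hy
    exact h (mem_toLeft.1 hx) (mem_toLeft.1 hy)
  rw [TensorNetwork.logCost_eq_sum h, D.rest_logCost_eq hl]
  have h1 : ∑ e ∈ D.restEdges A.toLeft B.toLeft, D.weight e
      = ∑ e ∈ (D.restEdges A.toLeft B.toLeft).map ⟨Sum.inl, Sum.inl_injective⟩,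
        S.network.weight e := by
    rw [sum_map]
    rfl
  -- The three families of embedding edges are told apart by their sources: in `A`, in `B`, or
  -- outside of both.
  have hd1 : Disjoint ((S.directed σ).leaving A A) ((S.directed σ).leaving B B) := by
    rw [disjoint_left] at h ⊢
    intro e he he'
    exact h (DirectedNetwork.mem_leaving.1 he).2.1 (DirectedNetwork.mem_leaving.1 he').2.1
  have hd2 : Disjoint ((S.directed σ).leaving A A ∪ (S.directed σ).leaving B B)
      ((S.directed σ).entering (A ∪ B)) := by
    rw [disjoint_left]
    intro e he he'
    simp only [mem_union, DirectedNetwork.mem_leaving, DirectedNetwork.mem_entering] at he he'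
    tauto
  have hsub : (S.directed σ).leaving A A ∪ (S.directed σ).leaving B B ∪
      (S.directed σ).entering (A ∪ B) ⊆ S.edges := by
    intro e he
    simp only [mem_union, DirectedNetwork.mem_leaving, DirectedNetwork.mem_entering,
      directed_edges] at he
    tauto
  rw [h1, DirectedNetwork.outW, DirectedNetwork.outW, DirectedNetwork.innW, directed_weight,
    ← sum_union hd1, ← sum_union hd2, ← sum_union]
  · refine TensorNetwork.sum_weight_mono (union_subset ?_ (union_subset (union_subset ?_ ?_) ?_))
    · intro e he
      obtain ⟨e, he', rfl⟩ := mem_map.1 he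
      rw [DataNetwork.restEdges, mem_sdiff, mem_union] at he'
      simpa [inl_mem_edgesOut he'.2] using he'.1
    · exact (leaving_subset_edgesOut A).trans subset_union_left
    · exact (leaving_subset_edgesOut B).trans subset_union_right
    · exact entering_subset_edgesOut A B
  · rw [disjoint_left]
    intro e he he'
    obtain ⟨e, hr, rfl⟩ := mem_map.1 he
    have := hsub he'
    simp only [edges, Function.Embedding.coeFn_mk, inl_mem_disjSum] at this
    exact (mem_sdiff.1 hr).2 this

/-- A sketched edge leaves each set with its data tensor and without embedding tensors. -/
theorem weight_le_outW {A : Finset (VD ⊕ VE)} {j : D.Sketched} (hj : Sum.inl (D.vertex j) ∈ A)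
    (hA : ∀ w, Sum.inr w ∉ A) : Real.log (D.size j.1) ≤ (S.directed σ).outW A := by
  have he : Sum.inl j.1 ∈ S.edges := by simp [edges]
  have hmem : Sum.inl j.1 ∈ (S.directed σ).leaving A A := by
    rw [DirectedNetwork.mem_leaving, directed_edges]
    have hdst : ∀ x ∈ (S.directed σ).dst (Sum.inl j.1), ∃ w, x = Sum.inr w := by
      intro x hx
      have := pos_dst he hx
      rcases x with x | x
      · simp [position] at this
      · exact ⟨x, rfl⟩
    refine ⟨he, ?_, fun x hx hxA => ?_⟩
    · have h1 : Sum.inl (D.vertex j) ∈ S.network.inc (Sum.inl j.1) := by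
        simp [network, D.inc_sketched j]
      rcases (mem_inc_iff he (σ := σ)).1 h1 with h | h
      · rwa [← h]
      · obtain ⟨w, hw⟩ := hdst _ h
        simp at hw
    · obtain ⟨w, rfl⟩ := hdst x hx
      exact hA w hxA
  have := single_le_sum (f := (S.directed σ).weight)
    (fun e _ => (S.directed σ).weight_nonneg e) hmem
  rw [directed_weight] at this
  rw [DirectedNetwork.outW, directed_weight]
  exact this

/-- A data tensor v_j emits its sketched edge, of size above m. An embedding tensor has row size at
least κK, and K ≥ m/κ₂. The minimum with 1 covers both cases and makes the logarithm nonpositive. -/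
theorem le_outW_singleton {κ κ₁ κ₂ ε δ : ℝ} (hκ : 0 < κ) (hκ₂ : 0 < κ₂)
    (hS : S.Admissible σ κ κ₁ κ₂ ε δ) (hs : ∀ e ∈ D.sketched, S.m < D.size e) :
    ∀ v ∈ (S.directed σ).active,
      Real.log (min 1 (κ / κ₂)) + Real.log S.m ≤ (S.directed σ).outW {v} := by
  have hm : (0 : ℝ) < S.m := by exact_mod_cast S.m_pos
  have hc : 0 < min 1 (κ / κ₂) := lt_min one_pos (div_pos hκ hκ₂)
  rintro (v | w) hv
  · obtain ⟨j, rfl⟩ := inl_mem_active.1 hv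
    refine le_trans ?_ (weight_le_outW (j := j) (by simp) (by simp))
    have h1 : Real.log (min 1 (κ / κ₂)) ≤ 0 := Real.log_nonpos hc.le (min_le_left _ _)
    have h2 : Real.log S.m ≤ Real.log (D.size j.1) :=
      Real.log_le_log hm (by exact_mod_cast (hs _ j.2).le)
    linarith
  · rw [← Real.log_mul hc.ne' hm.ne', Real.log_le_iff_le_exp (mul_pos hc hm), ← cutLin_eq]
    refine le_trans ?_ (hS.1 w)
    calc min 1 (κ / κ₂) * (S.m : ℝ) ≤ κ / κ₂ * S.m :=
          mul_le_mul_of_nonneg_right (min_le_right _ _) hm.le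
      _ ≤ κ / κ₂ * (κ₂ * (Fintype.card VE * Real.log (1 / δ) / ε ^ 2)) :=
          mul_le_mul_of_nonneg_left hS.2.2 (div_pos hκ hκ₂).le
      _ = _ := by field_simp

theorem log_m_lt_outW_singleton (hs : ∀ e ∈ D.sketched, S.m < D.size e) :
    ∀ v ∈ (S.directed σ).active, (S.directed σ).pos v = 0 →
      Real.log S.m < (S.directed σ).outW {v} := by
  rintro (v | w) hv h0
  · obtain ⟨j, rfl⟩ := inl_mem_active.1 hv
    refine lt_of_lt_of_le ?_ (weight_le_outW (j := j) (by simp) (by simp))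
    exact Real.log_lt_log (by exact_mod_cast S.m_pos) (by exact_mod_cast (hs _ j.2))
  · rw [directed_pos] at h0
    simp [position] at h0

/-- Only the output edge has no target. Since log m ≤ (3/2) log m, no debit is left at the root. -/
theorem outW_univ : (S.directed σ).outW univ ≤ Real.log S.m := by
  have : (S.directed σ).leaving univ univ ⊆ {Sum.inr none} := by
    intro e he
    rw [DirectedNetwork.mem_leaving, directed_edges] at he
    have h : (S.directed σ).dst e = none := by
      rcases hd : (S.directed σ).dst e with _ | x
      · rfl
      · exact absurd (mem_univ x) (he.2.2 x hd)
    rw [← dangling_iff he.1] at h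
    rcases e with e | _ | f
    · have h' : e ∈ D.sketched := by simpa [edges] using he.1
      simp [network, h'] at h
    · simp
    · simp [network] at h
  refine (DirectedNetwork.sum_mono this).trans ?_
  rw [sum_singleton, directed_weight]
  rfl

theorem card_sources_univ : ((S.directed σ).sources univ).card = D.order := by
  have : (S.directed σ).sources univ = univ.image (Sum.inl ∘ D.vertex) := by
    ext x
    rw [DirectedNetwork.mem_sources, directed_pos, mem_image]
    rcases x with v | w
    · simp [inl_mem_active, position]
    · simp [position]
  rw [this, card_image_of_injective _ (Sum.inl_injective.comp D.vertex_injective), card_univ,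
    Fintype.card_coe, DataNetwork.order]

end Embedding

/-! ### Costs in the data network with one sketching matrix. -/

namespace DataNetwork

variable {VD ED : Type*} [Fintype VD] [DecidableEq VD] [Fintype ED] [DecidableEq ED]
  {D : DataNetwork VD ED}

/-- Cost of a contraction in a subnetwork with a sketching matrix. -/
theorem withMatrix_logCost_le {X : Finset VD} {j : D.Sketched} (hX : D.sketchedAt X = {j})
    {m : ℕ} (hm : 0 < m) {A B : Finset (VD ⊕ Unit)} (h : Disjoint A B) (hA : A.toLeft ⊆ X)
    (hB : B.toLeft ⊆ X) :
    (D.withMatrix j m hm).logCost A B ≤ D.rest.logCost A.toLeft B.toLeft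
      + (if Sum.inl j.1 ∈ (D.withMatrix j m hm).edgesOut A ∪ (D.withMatrix j m hm).edgesOut B
          then Real.log (D.size j.1) else 0)
      + (if Sum.inr () ∈ A ∪ B then Real.log m else 0) := by
  have hl : Disjoint A.toLeft B.toLeft := by
    rw [disjoint_left] at h ⊢
    intro x hx hy
    exact h (mem_toLeft.1 hx) (mem_toLeft.1 hy)
  set H := D.withMatrix j m hm with hH
  -- The other sketched edges sit at tensors outside `X`, so only `j` can contribute.
  have hk : ∀ k : D.Sketched, k ≠ j → ∀ A : Finset (VD ⊕ Unit), A.toLeft ⊆ X →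
      Sum.inl k.1 ∉ H.edgesOut A := by
    intro k hkj A hA hk
    rw [TensorNetwork.mem_edgesOut] at hk
    obtain ⟨v, hv, hvA⟩ := hk.1
    have hkj' : k.1 ≠ j.1 := fun h => hkj (Subtype.ext h)
    rcases v with v | v
    · simp [hH, withMatrix, D.inc_sketched k] at hv
      have h1 : k ∈ D.sketchedAt X := mem_sketchedAt.2 (hv ▸ hA (mem_toLeft.2 hvA))
      rw [hX, mem_singleton] at h1
      exact hkj h1
    · simp [hH, withMatrix, hkj'] at hv
  have hr : ∀ e ∉ D.sketched, ∀ A : Finset (VD ⊕ Unit), Sum.inl e ∈ H.edgesOut A →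
      e ∈ D.toTensorNetwork.edgesOut A.toLeft := by
    intro e he A heA
    have hej : e ≠ j.1 := fun h => he (h ▸ j.2)
    simpa [TensorNetwork.mem_edgesOut, hH, withMatrix, hej] using heA
  rw [TensorNetwork.logCost_eq_sum h, D.rest_logCost_eq hl]
  have hsub : H.edgesOut A ∪ H.edgesOut B ⊆
      (D.restEdges A.toLeft B.toLeft ∪
        (if Sum.inl j.1 ∈ H.edgesOut A ∪ H.edgesOut B then {j.1} else ∅)).disjSum
      (if Sum.inr () ∈ A ∪ B then {()} else ∅) := by
    rintro (e | e) he
    · rw [inl_mem_disjSum, mem_union]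
      by_cases hs : e ∈ D.sketched
      · have hej : (⟨e, hs⟩ : D.Sketched) = j := by
          by_contra hne
          rcases mem_union.1 he with h | h
          · exact hk _ hne A hA h
          · exact hk _ hne B hB h
        subst hej
        rw [if_pos he]
        simp
      · left
        rw [restEdges, mem_sdiff, mem_union]
        rcases mem_union.1 he with h | h
        · exact ⟨Or.inl (hr e hs A h), hs⟩
        · exact ⟨Or.inr (hr e hs B h), hs⟩
    · have : Sum.inr () ∈ A ∪ B := by
        simp only [mem_union, TensorNetwork.mem_edgesOut] at he ⊢
        rcases he with ⟨⟨v, hv, h⟩, -⟩ | ⟨⟨v, hv, h⟩, -⟩ <;>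
        · simp only [hH, withMatrix, mem_singleton] at hv
          subst hv
          simp [h]
      rw [if_pos this]
      simp
  refine (TensorNetwork.sum_weight_mono hsub).trans ?_
  rw [sum_disjSum, sum_union]
  · refine le_of_eq ?_
    congr 1
    · congr 1
      split_ifs
      · rw [sum_singleton]; rfl
      · simp
    · split_ifs
      · rw [sum_singleton]; rfl
      · simp
  · split_ifs
    · rw [disjoint_singleton_right, restEdges, mem_sdiff]
      exact fun h => h.2 j.2
    · simp

theorem sketched_mem_edgesOut_iff {j : D.Sketched} {m : ℕ} (hm : 0 < m)
    {A : Finset (VD ⊕ Unit)} : Sum.inl j.1 ∈ (D.withMatrix j m hm).edgesOut A ↔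
      (Sum.inl (D.vertex j) ∈ A ↔ Sum.inr () ∉ A) := by
  simp [TensorNetwork.mem_edgesOut, withMatrix, D.inc_sketched j]
  tauto

end DataNetwork

/-! ### Attaching a vertex to a tree, and trees constrained on a data tree. -/

namespace ContractionTree

variable {V W : Type*} [DecidableEq V] [DecidableEq W]

/-- The same tree on the left summand of a larger vertex type. -/
def lift (W : Type*) : ContractionTree V → ContractionTree (V ⊕ W)
  | leaf v => leaf (Sum.inl v)
  | node l r => node (lift W l) (lift W r)

theorem disjSum_union (A B : Finset V) (C C' : Finset W) :
    A.disjSum C ∪ B.disjSum C' = (A ∪ B).disjSum (C ∪ C') := by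
  ext (x | x) <;> simp

omit [DecidableEq V] [DecidableEq W] in
theorem disjoint_disjSum {A B : Finset V} {C C' : Finset W} (h : Disjoint A B)
    (h' : Disjoint C C') : Disjoint (A.disjSum C) (B.disjSum C') := by
  rw [disjoint_left] at h h' ⊢
  rintro (x | x)
  · simpa using @h x
  · simpa using @h' x

theorem verts_lift (T : ContractionTree V) : (T.lift W).verts = T.verts.disjSum ∅ := by
  induction T with
  | leaf v => ext (x | x) <;> simp [lift, verts]
  | node l r hl hr => rw [lift, verts, hl, hr, verts, disjSum_union, union_empty]

theorem Proper.lift {T : ContractionTree V} (hT : T.Proper) : (T.lift W).Proper := by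
  induction T with
  | leaf v => trivial
  | node l r hl hr =>
    refine ⟨hl hT.1, hr hT.2.1, ?_⟩
    rw [verts_lift, verts_lift]
    exact disjoint_disjSum hT.2.2 (disjoint_empty_left _)

theorem contractions_lift (T : ContractionTree V) : (T.lift W).contractions =
    T.contractions.image fun p => (p.1.disjSum ∅, p.2.disjSum ∅) := by
  induction T with
  | leaf v => simp [lift, contractions]
  | node l r hl hr =>
    rw [lift, contractions, hl, hr, contractions, image_insert, image_union, verts_lift, verts_lift]

/-- The set `A` together with the additional vertex, if `A` contains `P`. -/
def extend (P A : Finset V) : Finset (V ⊕ Unit) := A.disjSum (if P ⊆ A then {()} else ∅)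

theorem toLeft_extend (P A : Finset V) : (extend P A).toLeft = A := by
  ext x
  simp [extend]

theorem contractions_lift_eq_extend {T : ContractionTree V} {P : Finset V}
    (h : ∀ p ∈ T.contractions, ¬ P ⊆ p.1 ∧ ¬ P ⊆ p.2) : (T.lift Unit).contractions =
      T.contractions.image fun p => (extend P p.1, extend P p.2) := by
  rw [contractions_lift]
  refine image_congr fun p hp => ?_
  simp only [extend, if_neg (h p hp).1, if_neg (h p hp).2]

/-- A further vertex can be attached at each node of a tree. -/
theorem Proper.exists_attach {T : ContractionTree V} (hT : T.Proper) {P : Finset V}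
    (hP : P ∈ T.nodes) : ∃ T' : ContractionTree (V ⊕ Unit), T'.IsTreeOf (T.verts.disjSum {()}) ∧
      T'.contractions = insert (P.disjSum ∅, {Sum.inr ()})
        (T.contractions.image fun p => (extend P p.1, extend P p.2)) := by
  -- Attachment at the root: no input of a contraction is the whole tree, so `extend` adds nothing
  -- below. The induction then descends to the child containing `P`.
  have main : ∀ T : ContractionTree V, T.Proper → ∃ T' : ContractionTree (V ⊕ Unit),
      T'.IsTreeOf (T.verts.disjSum {()}) ∧
      T'.contractions = insert (T.verts.disjSum ∅, {Sum.inr ()})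
        (T.contractions.image fun p => (extend T.verts p.1, extend T.verts p.2)) := by
    intro T hT
    refine ⟨node (T.lift Unit) (leaf (Sum.inr ())), ⟨⟨hT.lift, trivial, ?_⟩, ?_⟩, ?_⟩
    · simp [verts_lift, verts]
    · rw [verts, verts_lift, verts]
      ext (x | x) <;> simp
    · rw [contractions, verts_lift, verts, contractions, union_empty,
        contractions_lift_eq_extend]
      intro p hp
      have h1 := union_subset_verts hp
      obtain ⟨x, hx⟩ := fst_nonempty hp
      obtain ⟨y, hy⟩ := snd_nonempty hp
      have hd := disjoint_left.1 (hT.disjoint hp)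
      exact ⟨fun h => hd (h (h1 (mem_union_right _ hy))) hy,
        fun h => hd hx (h (h1 (mem_union_left _ hx)))⟩
  induction T with
  | leaf v =>
    obtain rfl : P = {v} := by simpa [nodes] using hP
    exact main (leaf v) hT
  | node l r hl hr =>
    simp only [nodes, mem_insert, mem_union] at hP
    rcases hP with rfl | hP | hP
    · exact main (node l r) hT
    · obtain ⟨t, ht, htc⟩ := hl hT.1 hP
      have hPl := subset_verts hP
      have hPr : ∀ A ⊆ r.verts, ¬ P ⊆ A := fun A hA h =>
        hT.not_subset_both (nonempty_of_mem_nodes hP) hPl (h.trans hA)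
      refine ⟨node t (r.lift Unit), ⟨⟨ht.1, hT.2.1.lift, ?_⟩, ?_⟩, ?_⟩
      · rw [ht.2, verts_lift]
        exact disjoint_disjSum hT.2.2 (disjoint_empty_right _)
      · rw [verts, ht.2, verts_lift, disjSum_union, union_empty, verts]
      · rw [contractions, ht.2, htc, verts_lift, contractions_lift_eq_extend (P := P), contractions,
          image_insert, image_union]
        · simp only [extend, if_pos hPl, if_neg (hPr _ subset_rfl)]
          rw [insert_union, insert_comm]
        · intro p hp
          have := union_subset_iff.1 (union_subset_verts hp)
          exact ⟨hPr _ this.1, hPr _ this.2⟩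
    · obtain ⟨t, ht, htc⟩ := hr hT.2.1 hP
      have hPr := subset_verts hP
      have hPl : ∀ A ⊆ l.verts, ¬ P ⊆ A := fun A hA h =>
        hT.not_subset_both (nonempty_of_mem_nodes hP) (h.trans hA) hPr
      refine ⟨node (l.lift Unit) t, ⟨⟨hT.1.lift, ht.1, ?_⟩, ?_⟩, ?_⟩
      · rw [ht.2, verts_lift]
        exact disjoint_disjSum hT.2.2 (disjoint_empty_left _)
      · rw [verts, ht.2, verts_lift, disjSum_union, empty_union, verts]
      · rw [contractions, ht.2, htc, verts_lift, contractions_lift_eq_extend (P := P), contractions,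
          image_insert, image_union]
        · simp only [extend, if_pos hPr, if_neg (hPl _ subset_rfl)]
          rw [union_insert, insert_comm]
        · intro p hp
          have := union_subset_iff.1 (union_subset_verts hp)
          exact ⟨hPl _ this.1, hPl _ this.2⟩

/-- The contraction `q` of all tensors restricts to the contraction `p` of the data. -/
def Matches (q : Finset (V ⊕ W) × Finset (V ⊕ W)) (p : Finset V × Finset V) : Prop :=
  (q.1.toLeft = p.1 ∧ q.2.toLeft = p.2) ∨ (q.1.toLeft = p.2 ∧ q.2.toLeft = p.1)

omit [DecidableEq W] in
theorem Matches.union_eq {q : Finset (V ⊕ W) × Finset (V ⊕ W)} {p : Finset V × Finset V}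
    (h : Matches q p) : q.1.toLeft ∪ q.2.toLeft = p.1 ∪ p.2 := by
  rcases h with ⟨h1, h2⟩ | ⟨h1, h2⟩
  · rw [h1, h2]
  · rw [h1, h2, union_comm]

/-- The data tensors of a node of a constrained tree form a node of the data tree. -/
theorem toLeft_mem_nodes {T : ContractionTree (V ⊕ W)} (hT : T.Proper) {T₀ : ContractionTree V}
    (hc : T.RespectsContractions T₀.contractions) {M : Finset (V ⊕ W)} (hM : M ∈ T.nodes)
    (hne : M.toLeft.Nonempty) (hsub : M.toLeft ⊆ T₀.verts) : M.toLeft ∈ T₀.nodes := by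
  induction T₀ with
  | leaf v =>
    simp only [verts, nodes, mem_singleton] at *
    exact hne.subset_singleton_iff.1 hsub
  | node l r hl hr =>
    have hcl : T.RespectsContractions l.contractions := fun p hp =>
      hc p (by simp [contractions, hp])
    have hcr : T.RespectsContractions r.contractions := fun p hp =>
      hc p (by simp [contractions, hp])
    simp only [nodes, mem_insert, mem_union]
    by_cases h1 : M.toLeft ⊆ l.verts
    · exact Or.inr (Or.inl (hl hcl h1))
    by_cases h2 : M.toLeft ⊆ r.verts
    · exact Or.inr (Or.inr (hr hcr h2))
    left
    -- A node whose data lie in neither child must contain both inputs of the contraction matching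
    -- the root of `T₀`, hence all of its data.
    obtain ⟨q, hq, hqp⟩ := hc (l.verts, r.verts) (by simp [contractions])
    have hu := Matches.union_eq (p := (l.verts, r.verts)) hqp
    rcases hT.node_cases hq hM with h | h | h | h
    · refine subset_antisymm hsub ?_
      rw [← hu, ← toLeft_union]
      exact toLeft_subset_toLeft h
    · have := toLeft_subset_toLeft h
      rcases hqp with ⟨h3, -⟩ | ⟨h3, -⟩ <;> rw [h3] at this <;> contradiction
    · have := toLeft_subset_toLeft h
      rcases hqp with ⟨-, h3⟩ | ⟨-, h3⟩ <;> rw [h3] at this <;> contradiction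
    · obtain ⟨x, hx⟩ := hne
      have h4 : x ∈ q.1.toLeft ∪ q.2.toLeft := hu ▸ hsub hx
      rw [← toLeft_union, mem_toLeft] at h4
      exact (disjoint_left.1 h (mem_toLeft.1 hx) h4).elim

/-- The first contraction above a leaf of the left summand that involves the right summand. -/
theorem exists_first_mixed (T : ContractionTree (V ⊕ W)) {v : V} (hv : Sum.inl v ∈ T.verts)
    (hw : ∃ w, Sum.inr w ∈ T.verts) : ∃ P Q, ((P, Q) ∈ T.contractions ∨ (Q, P) ∈ T.contractions) ∧
      Sum.inl v ∈ P ∧ (∀ w, Sum.inr w ∉ P) ∧ ∃ w, Sum.inr w ∈ Q := by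
  induction T with
  | leaf x =>
    obtain ⟨w, hw⟩ := hw
    simp only [verts, mem_singleton] at hv hw
    rw [← hv] at hw
    cases hw
  | node l r hl hr =>
    simp only [verts, mem_union] at hv hw
    simp only [contractions, mem_insert, mem_union]
    rcases hv with hv | hv
    · by_cases h : ∃ w, Sum.inr w ∈ l.verts
      · obtain ⟨P, Q, h1, h2⟩ := hl hv h
        exact ⟨P, Q, by tauto, h2⟩
      · rw [not_exists] at h
        obtain ⟨w, hw⟩ := hw
        exact ⟨l.verts, r.verts, Or.inl (Or.inl rfl), hv, h, w, hw.resolve_left (h w)⟩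
    · by_cases h : ∃ w, Sum.inr w ∈ r.verts
      · obtain ⟨P, Q, h1, h2⟩ := hr hv h
        exact ⟨P, Q, by tauto, h2⟩
      · rw [not_exists] at h
        obtain ⟨w, hw⟩ := hw
        exact ⟨r.verts, l.verts, Or.inr (Or.inl rfl), hv, h, w, hw.resolve_right (h w)⟩

/-- A node meeting both inputs of a contraction contains them entirely, including their vertices of
the right summand. So a set free of embedding tensors has only such contractions below it. -/
theorem Proper.union_subset_node {T : ContractionTree (V ⊕ W)} (hT : T.Proper)
    {P : Finset (V ⊕ W)} (hP : P ∈ T.nodes) {q : Finset (V ⊕ W) × Finset (V ⊕ W)}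
    (hq : q ∈ T.contractions) (h1 : q.1.toLeft.Nonempty) (h2 : q.2.toLeft.Nonempty)
    (h : q.1.toLeft ∪ q.2.toLeft ⊆ P.toLeft) : q.1 ∪ q.2 ⊆ P := by
  have hd := disjoint_left.1 (hT.disjoint hq)
  obtain ⟨x, hx⟩ := h1
  obtain ⟨y, hy⟩ := h2
  have hxP := mem_toLeft.1 (h (mem_union_left _ hx))
  have hyP := mem_toLeft.1 (h (mem_union_right _ hy))
  rw [mem_toLeft] at hx hy
  rcases hT.node_cases hq hP with h | h | h | h
  · exact h
  · exact (hd (h hyP) hy).elim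
  · exact (hd hx (h hxP)).elim
  · exact (disjoint_left.1 h hxP (mem_union_left _ hx)).elim

end ContractionTree

/-! ### The subnetworks X(e_j). -/

namespace DataNetwork

variable {VD ED : Type*} [Fintype VD] [DecidableEq VD] [Fintype ED] [DecidableEq ED]
  {D : DataNetwork VD ED} {T₀ : ContractionTree VD}

omit [Fintype VD] [Fintype ED] in
theorem union_subset_subnet {j : D.Sketched} {p : Finset VD × Finset VD}
    (hp : p ∈ T₀.contractions) (h : D.sketchedAt (p.1 ∪ p.2) = {j}) :
    p.1 ∪ p.2 ⊆ D.subnet T₀ j :=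
  (subset_biUnion_of_mem (fun p : Finset VD × Finset VD => p.1 ∪ p.2)
    (mem_filter.2 ⟨hp, h⟩)).trans (subset_insert _ _)

theorem sketchedAt_singleton (j : D.Sketched) : D.sketchedAt {D.vertex j} = {j} := by
  ext k
  simp [mem_sketchedAt, D.vertex_injective.eq_iff]

/-- Nodes whose only sketched edge is `j` all contain v_j, so they form a chain by laminarity;
X(e_j) is its largest member. -/
theorem subnet_spec (hT : T₀.Proper) (j : D.Sketched) (hj : D.vertex j ∈ T₀.verts) :
    D.subnet T₀ j ∈ T₀.nodes ∧ D.sketchedAt (D.subnet T₀ j) = {j} := by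
  obtain ⟨M, hM⟩ := (T₀.nodes.filter fun M => D.sketchedAt M = {j}).exists_maximal
    ⟨_, mem_filter.2 ⟨ContractionTree.singleton_mem_nodes hj, sketchedAt_singleton j⟩⟩
  obtain ⟨hMn, hMj⟩ := mem_filter.1 hM.1
  have hjM : ∀ A, D.sketchedAt A = {j} → D.vertex j ∈ A := fun A hA =>
    mem_sketchedAt.1 (hA ▸ mem_singleton_self j)
  have : D.subnet T₀ j = M := by
    apply subset_antisymm
    · refine insert_subset (hjM M hMj) (biUnion_subset.2 fun p hp => ?_)
      obtain ⟨hp, hpj⟩ := mem_filter.1 hp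
      have hpn := (ContractionTree.mem_nodes_of_mem_contractions hp).2.2
      rcases hT.laminar hMn hpn with h | h | h
      · exact hM.2 (mem_filter.2 ⟨hpn, hpj⟩) h
      · exact h
      · exact (disjoint_left.1 h (hjM _ hMj) (hjM _ hpj)).elim
    · rcases ContractionTree.eq_singleton_or_union hMn with ⟨v, rfl⟩ | ⟨p, hp, rfl⟩
      · have := mem_singleton.1 (hjM _ hMj)
        rw [← this]
        exact singleton_subset_iff.2 (mem_insert_self _ _)
      · exact union_subset_subnet hp hMj
  rw [this]
  exact ⟨hMn, hMj⟩

omit [Fintype VD] [Fintype ED] in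
theorem vertex_mem_subnet (j : D.Sketched) : D.vertex j ∈ D.subnet T₀ j := mem_insert_self _ _

theorem subnet_disjoint (hT : T₀.Proper) (hv : T₀.verts = univ) {j k : D.Sketched} (hjk : j ≠ k) :
    Disjoint (D.subnet T₀ j) (D.subnet T₀ k) := by
  obtain ⟨h1, h2⟩ := subnet_spec hT j (hv ▸ mem_univ _)
  obtain ⟨h3, h4⟩ := subnet_spec hT k (hv ▸ mem_univ _)
  rcases hT.laminar h1 h3 with h | h | h
  · have : j ∈ D.sketchedAt (D.subnet T₀ k) := mem_sketchedAt.2 (h (vertex_mem_subnet j))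
    rw [h4, mem_singleton] at this
    exact (hjk this).elim
  · have : k ∈ D.sketchedAt (D.subnet T₀ j) := mem_sketchedAt.2 (h (vertex_mem_subnet k))
    rw [h2, mem_singleton] at this
    exact (hjk this.symm).elim
  · exact h

end DataNetwork

/-! ### Charging the sketching costs t_j to contractions of the overall tree. -/

namespace Embedding

open ContractionTree

variable {VD ED VE FE : Type*} [Fintype VD] [DecidableEq VD] [Fintype ED] [DecidableEq ED]
  [Fintype VE] [DecidableEq VE] [Fintype FE] [DecidableEq FE] {D : DataNetwork VD ED}
  {S : Embedding D VE FE} {σ : VE ≃ Fin (Fintype.card VE)}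

theorem le_logCost_of_matches {q : Finset (VD ⊕ VE) × Finset (VD ⊕ VE)}
    {p : Finset VD × Finset VD} (hq : Disjoint q.1 q.2) (h : Matches q p) :
    D.rest.logCost p.1 p.2 + ((S.directed σ).outW q.1 + (S.directed σ).outW q.2)
      ≤ S.network.logCost q.1 q.2 := by
  have h1 := S.le_logCost (σ := σ) hq
  have h2 := (S.directed σ).innW_nonneg (q.1 ∪ q.2)
  have h3 : D.rest.logCost q.1.toLeft q.2.toLeft = D.rest.logCost p.1 p.2 := by
    rcases h with ⟨h3, h4⟩ | ⟨h3, h4⟩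
    · rw [h3, h4]
    · rw [h3, h4, TensorNetwork.logCost_comm]
  linarith

theorem cut_add_le_logCost {A B : Finset (VD ⊕ VE)} (h : Disjoint A B) :
    D.rest.cut A.toLeft + ((S.directed σ).outW A + (S.directed σ).outW B)
      ≤ S.network.logCost A B := by
  have hl : Disjoint A.toLeft B.toLeft := by
    rw [disjoint_left] at h ⊢
    intro x hx hy
    exact h (mem_toLeft.1 hx) (mem_toLeft.1 hy)
  have h1 := S.le_logCost (σ := σ) h
  have h2 := (S.directed σ).innW_nonneg (A ∪ B)
  have h3 := TensorNetwork.cut_le_logCost (G := D.rest) hl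
  linarith

theorem le_outW_of_vertex_mem {a : ℝ} (ha : ∀ v ∈ (S.directed σ).active, a ≤ (S.directed σ).outW {v})
    {A : Finset (VD ⊕ VE)} {j : D.Sketched} (hj : Sum.inl (D.vertex j) ∈ A) :
    a ≤ (S.directed σ).outW A :=
  DirectedNetwork.le_outW ha ⟨_, mem_inter.2 ⟨hj, inl_mem_active.2 ⟨j, rfl⟩⟩⟩

theorem le_outW_of_inr_mem {a : ℝ} (ha : ∀ v ∈ (S.directed σ).active, a ≤ (S.directed σ).outW {v})
    {A : Finset (VD ⊕ VE)} {w : VE} (hw : Sum.inr w ∈ A) : a ≤ (S.directed σ).outW A :=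
  DirectedNetwork.le_outW ha ⟨_, mem_inter.2 ⟨hw, inr_mem_active w⟩⟩

/-- The contractions with an input whose data tensors are in `X`. -/
def touching (T : ContractionTree (VD ⊕ VE)) (X : Finset VD) :
    Finset (Finset (VD ⊕ VE) × Finset (VD ⊕ VE)) :=
  T.contractions.filter fun q =>
    (q.1.toLeft.Nonempty ∧ q.1.toLeft ⊆ X) ∨ (q.2.toLeft.Nonempty ∧ q.2.toLeft ⊆ X)

/-- The contraction at which the sketched edge `j` is to be sketched in the subnetwork, and a
contraction of the overall network which is at least as expensive. -/
theorem exists_sketching_node {T : ContractionTree (VD ⊕ VE)} (hT : T.IsTreeOf univ)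
    {T₀ : ContractionTree VD} (hT₀ : T₀.IsTreeOf univ) (hc : T.ConstrainedOn T₀) {a : ℝ}
    (ha : ∀ v ∈ (S.directed σ).active, a ≤ (S.directed σ).outW {v}) (j : D.Sketched) :
    ∃ P ∈ T₀.nodes, D.vertex j ∈ P ∧ P ⊆ D.subnet T₀ j ∧
      (∃ q ∈ touching T (D.subnet T₀ j),
        D.rest.cut P + (Real.log (D.size j.1) + a) ≤ S.network.logCost q.1 q.2) ∧
      ∀ p ∈ T₀.contractions, p.1 ∪ p.2 ⊆ P → ∀ q ∈ T.contractions, Matches q p →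
        ∀ w, Sum.inr w ∉ q.1 ∪ q.2 := by
  obtain ⟨P, Q, hPQ, hvP, hP, w, hw⟩ := exists_first_mixed T (v := D.vertex j)
    (hT.2 ▸ mem_univ _) ⟨S.out, hT.2 ▸ mem_univ _⟩
  have hPn : P ∈ T.nodes := by
    rcases hPQ with h | h
    · exact (mem_nodes_of_mem_contractions h).1
    · exact (mem_nodes_of_mem_contractions h).2.1
  have hdPQ : Disjoint P Q := by
    rcases hPQ with h | h
    · exact hT.1.disjoint h
    · exact (hT.1.disjoint h).symm
  have hvP' : D.vertex j ∈ P.toLeft := mem_toLeft.2 hvP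
  have hPn₀ : P.toLeft ∈ T₀.nodes :=
    toLeft_mem_nodes hT.1 hc hPn ⟨_, hvP'⟩ (hT₀.2 ▸ subset_univ _)
  have hpure : ∀ p ∈ T₀.contractions, p.1 ∪ p.2 ⊆ P.toLeft → ∀ q ∈ T.contractions, Matches q p →
      ∀ w, Sum.inr w ∉ q.1 ∪ q.2 := by
    intro p hp hpP q hq hqp w hw
    refine hP w (hT.1.union_subset_node hPn hq ?_ ?_ (hqp.union_eq ▸ hpP) hw)
    · rcases hqp with h | h
      · exact h.1 ▸ fst_nonempty hp
      · exact h.1 ▸ snd_nonempty hp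
    · rcases hqp with h | h
      · exact h.2 ▸ snd_nonempty hp
      · exact h.2 ▸ fst_nonempty hp
  obtain ⟨hXn, hX⟩ := DataNetwork.subnet_spec hT₀.1 j (hT₀.2 ▸ mem_univ _)
  have hvX := D.vertex_mem_subnet (T₀ := T₀) j
  -- `A` still carries the full unsketched edge `j`, while `B` emits at least `a`. Together with the
  -- cut of the data this covers the product with the matrix.
  have finish : ∀ A B : Finset (VD ⊕ VE), ((A, B) ∈ T.contractions ∨ (B, A) ∈ T.contractions) →
      Sum.inl (D.vertex j) ∈ A → (∀ w, Sum.inr w ∉ A) → A.toLeft ⊆ D.subnet T₀ j →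
      a ≤ (S.directed σ).outW B → ∃ q ∈ touching T (D.subnet T₀ j),
        D.rest.cut A.toLeft + (Real.log (D.size j.1) + a) ≤ S.network.logCost q.1 q.2 := by
    intro A B hAB hA hA' hAX hB
    have h1 := weight_le_outW (S := S) (σ := σ) hA hA'
    rcases hAB with h | h
    · have h2 := S.cut_add_le_logCost (σ := σ) (hT.1.disjoint h)
      exact ⟨_, mem_filter.2 ⟨h, Or.inl ⟨⟨_, mem_toLeft.2 hA⟩, hAX⟩⟩, by simp only at h2 ⊢; linarith⟩
    · have h2 := S.cut_add_le_logCost (σ := σ) (hT.1.disjoint h).symm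
      rw [TensorNetwork.logCost_comm] at h2
      exact ⟨_, mem_filter.2 ⟨h, Or.inr ⟨⟨_, mem_toLeft.2 hA⟩, hAX⟩⟩, by simp only at h2 ⊢; linarith⟩
  by_cases hPX : P.toLeft ⊆ D.subnet T₀ j
  · exact ⟨P.toLeft, hPn₀, hvP', hPX, finish P Q hPQ hvP hP hPX (le_outW_of_inr_mem ha hw), hpure⟩
  -- Here `T` sketches `j` only after leaving the subnetwork. The matrix is attached at X(e_j), and
  -- the charge goes to the contraction matching the parent `(X, Z)` of X(e_j) in `T₀`.
  · have hXP : D.subnet T₀ j ⊆ P.toLeft := by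
      rcases hT₀.1.laminar hXn hPn₀ with h | h | h
      · exact h
      · contradiction
      · exact (disjoint_left.1 h hvX hvP').elim
    refine ⟨D.subnet T₀ j, hXn, hvX, subset_rfl, ?_, fun p hp hpX => hpure p hp (hpX.trans hXP)⟩
    obtain ⟨p, hp, hpX⟩ := exists_parent hXn fun h => hPX (h ▸ hT₀.2 ▸ subset_univ _)
    obtain ⟨Z, hpZ⟩ : ∃ Z, p = (D.subnet T₀ j, Z) ∨ p = (Z, D.subnet T₀ j) := by
      rcases hpX with h | h
      · exact ⟨p.2, Or.inl (by rw [← h])⟩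
      · exact ⟨p.1, Or.inr (by rw [← h])⟩
    have hpu : p.1 ∪ p.2 = D.subnet T₀ j ∪ Z := by
      rcases hpZ with rfl | rfl
      · rfl
      · exact union_comm _ _
    have hXZ : Disjoint (D.subnet T₀ j) Z := by
      have := hT₀.1.disjoint hp
      rcases hpZ with rfl | rfl
      · exact this
      · exact this.symm
    have hZne : Z.Nonempty := by
      rcases hpZ with rfl | rfl
      · exact snd_nonempty hp
      · exact fst_nonempty hp
    have hpP : p.1 ∪ p.2 ⊆ P.toLeft := by
      have hvZ := disjoint_left.1 hXZ hvX
      have hcases : P.toLeft ⊆ p.1 ∨ P.toLeft ⊆ p.2 →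
          P.toLeft ⊆ D.subnet T₀ j ∨ P.toLeft ⊆ Z := by
        rcases hpZ with rfl | rfl
        · exact id
        · exact Or.symm
      rcases hT₀.1.node_cases hp hPn₀ with h | h | h | h
      · exact h
      · exact ((hcases (Or.inl h)).elim hPX fun h => hvZ (h hvP')).elim
      · exact ((hcases (Or.inr h)).elim hPX fun h => hvZ (h hvP')).elim
      · exact (disjoint_left.1 h hvP' (hpu ▸ mem_union_left _ hvX)).elim
    -- Without a sketched edge at `Z`, the contraction would belong to 𝒟(e_j) and `Z` would lie in
    -- X(e_j). So `Z` plays the role of the emitting set.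
    obtain ⟨k, hk⟩ : (D.sketchedAt Z).Nonempty := by
      by_contra hemp
      rw [not_nonempty_iff_eq_empty] at hemp
      have := DataNetwork.union_subset_subnet hp
        (by rw [hpu, DataNetwork.sketchedAt_union, hemp, hX, union_empty] : _ = {j})
      obtain ⟨z, hz⟩ := hZne
      exact disjoint_left.1 hXZ (this (hpu ▸ mem_union_right _ hz)) hz
    rw [DataNetwork.mem_sketchedAt] at hk
    obtain ⟨q, hq, hqp⟩ := hc p hp
    have hpq := hpure p hp hpP q hq hqp
    obtain ⟨A, B, hAB, hA, hB⟩ : ∃ A B, (q = (A, B) ∨ q = (B, A)) ∧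
        A.toLeft = D.subnet T₀ j ∧ B.toLeft = Z := by
      rcases hpZ with rfl | rfl <;> rcases hqp with h | h
      · exact ⟨q.1, q.2, Or.inl rfl, h.1, h.2⟩
      · exact ⟨q.2, q.1, Or.inr rfl, h.2, h.1⟩
      · exact ⟨q.2, q.1, Or.inr rfl, h.2, h.1⟩
      · exact ⟨q.1, q.2, Or.inl rfl, h.1, h.2⟩
    have hAq : A ⊆ q.1 ∪ q.2 := by
      rcases hAB with rfl | rfl
      · exact subset_union_left
      · exact subset_union_right
    rw [← hA]
    rw [← hA] at finish
    refine finish A B ?_ (mem_toLeft.1 (hA ▸ hvX)) (fun w hw => hpq w (hAq hw)) subset_rfl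
      (le_outW_of_vertex_mem ha (mem_toLeft.1 (hB ▸ hk)))
    rcases hAB with rfl | rfl
    · exact Or.inl hq
    · exact Or.inr hq

/-- A data contraction in the subnetwork of a sketched edge, with the sketching matrix attached at
the node `P`, is not much more expensive than the one of the overall network. -/
theorem withMatrix_logCost_extend_le {T : ContractionTree (VD ⊕ VE)} (hT : T.Proper)
    {T₀ : ContractionTree VD} (hT₀ : T₀.Proper) {γ : ℝ} (hγ : γ ≤ 0)
    (ha : ∀ v ∈ (S.directed σ).active, γ + Real.log S.m ≤ (S.directed σ).outW {v})
    {j : D.Sketched} {X P : Finset VD} (hX : D.sketchedAt X = {j}) (hP : P ∈ T₀.nodes)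
    (hjP : D.vertex j ∈ P) {p : Finset VD × Finset VD} (hp : p ∈ T₀.contractions)
    (hpX : p.1 ∪ p.2 ⊆ X) {q : Finset (VD ⊕ VE) × Finset (VD ⊕ VE)} (hq : q ∈ T.contractions)
    (hqp : Matches q p) (hpure : p.1 ∪ p.2 ⊆ P → ∀ w, Sum.inr w ∉ q.1 ∪ q.2) :
    γ + (D.withMatrix j S.m S.m_pos).logCost (extend P p.1) (extend P p.2)
      ≤ S.network.logCost q.1 q.2 := by
  have hd := disjoint_left.1 (hT₀.disjoint hp)
  have hdis : Disjoint (extend P p.1) (extend P p.2) := by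
    refine disjoint_disjSum (hT₀.disjoint hp) ?_
    by_cases h : P ⊆ p.1
    · rw [if_neg (show ¬ P ⊆ p.2 from fun h' => hd (h hjP) (h' hjP))]
      exact disjoint_empty_right _
    · rw [if_neg h]
      exact disjoint_empty_left _
  have hX' := union_subset_iff.1 hpX
  have h1 := DataNetwork.withMatrix_logCost_le hX S.m_pos hdis
    (by rw [toLeft_extend]; exact hX'.1) (by rw [toLeft_extend]; exact hX'.2)
  rw [toLeft_extend, toLeft_extend] at h1
  have hG := S.le_logCost_of_matches (σ := σ) (hT.disjoint hq) hqp
  have ho1 := (S.directed σ).outW_nonneg q.1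
  have ho2 := (S.directed σ).outW_nonneg q.2
  have hm0 : 0 ≤ Real.log S.m := Real.log_nonneg (by exact_mod_cast S.m_pos)
  have hinl : ∀ A : Finset VD, Sum.inl (D.vertex j) ∈ extend P A ↔ D.vertex j ∈ A := by
    simp [extend]
  have hinr : ∀ A : Finset VD, Sum.inr () ∈ extend P A ↔ P ⊆ A := by
    intro A
    by_cases h : P ⊆ A <;> simp [extend, h]
  simp only [mem_union, DataNetwork.sketched_mem_edgesOut_iff, hinl, hinr] at h1
  have hvq : D.vertex j ∈ p.1 ∪ p.2 →
      Sum.inl (D.vertex j) ∈ q.1 ∨ Sum.inl (D.vertex j) ∈ q.2 := by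
    intro h
    rw [← hqp.union_eq, mem_union, mem_toLeft, mem_toLeft] at h
    exact h
  -- If the matrix is already attached, the sketched edge is contracted and only the dimension m
  -- remains; the input of `q` containing v_j emits γ + log m.
  by_cases hcase : P ⊆ p.1 ∨ P ⊆ p.2
  · have hno : ¬ ((D.vertex j ∈ p.1 ↔ ¬ P ⊆ p.1) ∨ (D.vertex j ∈ p.2 ↔ ¬ P ⊆ p.2)) := by
      have e1 : P ⊆ p.1 → D.vertex j ∈ p.1 := fun h => h hjP
      have e2 : P ⊆ p.2 → D.vertex j ∈ p.2 := fun h => h hjP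
      have e3 := @hd (D.vertex j)
      tauto
    rw [if_neg hno, if_pos hcase] at h1
    have hv : D.vertex j ∈ p.1 ∪ p.2 := by
      rcases hcase with h | h
      · exact mem_union_left _ (h hjP)
      · exact mem_union_right _ (h hjP)
    rcases hvq hv with h | h
    · have := le_outW_of_vertex_mem ha h
      linarith
    · have := le_outW_of_vertex_mem ha h
      linarith
  · rw [if_neg hcase] at h1
    -- Before the attachment the sketched edge is present at full size, but then `q` has no
    -- embedding tensor and carries that edge as well.
    by_cases hv : D.vertex j ∈ p.1 ∪ p.2
    · have hPp : p.1 ∪ p.2 ⊆ P := by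
        rcases hT₀.node_cases hp hP with h | h | h | h
        · exact h
        · exact (hcase (Or.inl h)).elim
        · exact (hcase (Or.inr h)).elim
        · exact (disjoint_left.1 h hjP hv).elim
      have hpq := hpure hPp
      have hs0 : 0 ≤ Real.log (D.size j.1) :=
        Real.log_nonneg (by exact_mod_cast D.size_pos j.1)
      have h2 : D.rest.logCost p.1 p.2 + Real.log (D.size j.1) ≤ S.network.logCost q.1 q.2 := by
        rcases hvq hv with h | h
        · have := weight_le_outW (S := S) (σ := σ) h fun w hw => hpq w (mem_union_left _ hw)
          linarith
        · have := weight_le_outW (S := S) (σ := σ) h fun w hw => hpq w (mem_union_right _ hw)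
          linarith
      split_ifs at h1 <;> linarith
    · rw [mem_union, not_or] at hv
      have hno : ¬ ((D.vertex j ∈ p.1 ↔ ¬ P ⊆ p.1) ∨ (D.vertex j ∈ p.2 ↔ ¬ P ⊆ p.2)) := by
        tauto
      rw [if_neg hno] at h1
      linarith

omit [Fintype VD] [Fintype VE] in
/-- A choice of the contractions of the overall network matching those of the data. -/
theorem exists_matching {T : ContractionTree (VD ⊕ VE)} {T₀ : ContractionTree VD}
    (hT₀ : T₀.Proper) (hc : T.ConstrainedOn T₀) :
    ∃ q : Finset VD × Finset VD → Finset (VD ⊕ VE) × Finset (VD ⊕ VE),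
      (∀ p ∈ T₀.contractions, q p ∈ T.contractions ∧ Matches (q p) p) ∧
      Set.InjOn q T₀.contractions := by
  have : ∀ p, ∃ q, p ∈ T₀.contractions → q ∈ T.contractions ∧ Matches q p := by
    intro p
    by_cases hp : p ∈ T₀.contractions
    · obtain ⟨q, hq, h⟩ := hc p hp
      exact ⟨q, fun _ => ⟨hq, h⟩⟩
    · exact ⟨(∅, ∅), fun h => absurd h hp⟩
  choose q hq using this
  refine ⟨q, hq, fun p hp p' hp' h => hT₀.contraction_ext hp hp' ?_⟩
  rw [← (hq p hp).2.union_eq, ← (hq p' hp').2.union_eq, h]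

/-- The exponential of the cost exponent. -/
noncomputable def expCost (S : Embedding D VE FE)
    (q : Finset (VD ⊕ VE) × Finset (VD ⊕ VE)) : ℝ := Real.exp (S.network.logCost q.1 q.2)

theorem expCost_nonneg (q : Finset (VD ⊕ VE) × Finset (VD ⊕ VE)) : 0 ≤ S.expCost q :=
  (Real.exp_pos _).le

theorem sum_matching_le {s : Finset (Finset VD × Finset VD)}
    {F : Finset (Finset (VD ⊕ VE) × Finset (VD ⊕ VE))}
    {q : Finset VD × Finset VD → Finset (VD ⊕ VE) × Finset (VD ⊕ VE)}
    (hinj : Set.InjOn q s) (hF : ∀ p ∈ s, q p ∈ F) :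
    ∑ p ∈ s, S.expCost (q p) ≤ ∑ x ∈ F, S.expCost x := by
  rw [← sum_image hinj]
  refine sum_le_sum_of_subset_of_nonneg (image_subset_iff.2 hF) fun x _ _ => expCost_nonneg x

/-- The optimal cost of sketching the subnetwork of `j` is bounded by the costs of the contractions
touching it. -/
theorem sketchCost_le {T : ContractionTree (VD ⊕ VE)} (hT : T.IsTreeOf univ)
    {T₀ : ContractionTree VD} (hT₀ : T₀.IsTreeOf univ) (hc : T.ConstrainedOn T₀) {γ : ℝ}
    (hγ : γ ≤ 0)
    (ha : ∀ v ∈ (S.directed σ).active, γ + Real.log S.m ≤ (S.directed σ).outW {v})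
    (j : D.Sketched) :
    Real.exp γ * D.sketchCost T₀ j S.m S.m_pos
      ≤ 2 * ∑ q ∈ touching T (D.subnet T₀ j), S.expCost q := by
  obtain ⟨P, hP, hjP, hPX, ⟨q₁, hq₁, hcost⟩, hpure⟩ :=
    exists_sketching_node hT hT₀ hc ha j
  obtain ⟨hXn, hX⟩ := DataNetwork.subnet_spec hT₀.1 j (hT₀.2 ▸ mem_univ _)
  obtain ⟨t, ht, htc, htn⟩ := hT₀.1.exists_subtree hXn
  obtain ⟨T', hT', hT'c⟩ := ht.1.exists_attach (htn P hP hPX)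
  obtain ⟨q, hq, hinj⟩ := exists_matching hT₀.1 hc
  have hmem : ∀ p ∈ t.contractions, p ∈ T₀.contractions ∧ p.1 ∪ p.2 ⊆ D.subnet T₀ j := by
    intro p hp
    rw [htc] at hp
    exact mem_filter.1 hp
  set H := D.withMatrix j S.m S.m_pos with hH
  have hle : D.sketchCost T₀ j S.m S.m_pos ≤ T'.cost H := by
    refine csInf_le ⟨0, ?_⟩ ⟨T', ht.2 ▸ hT', ?_, rfl⟩
    · rintro x ⟨T'', -, -, rfl⟩
      exact sum_nonneg fun _ _ => (Real.exp_pos _).le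
    · rw [← htc]
      intro p hp
      refine ⟨_, hT'c ▸ mem_insert_of_mem (mem_image_of_mem _ hp), Or.inl ⟨?_, ?_⟩⟩
      · exact toLeft_extend P p.1
      · exact toLeft_extend P p.2
  have hcost₁ : γ + H.logCost (P.disjSum ∅) {Sum.inr ()} ≤ S.network.logCost q₁.1 q₁.2 := by
    have h1 := DataNetwork.withMatrix_logCost_le hX S.m_pos (A := P.disjSum ∅) (B := {Sum.inr ()})
      (by simp) (by rwa [toLeft_disjSum]) (by
        intro x hx
        simp at hx)
    have h2 : D.rest.logCost (P.disjSum (∅ : Finset Unit)).toLeft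
        ({Sum.inr ()} : Finset (VD ⊕ Unit)).toLeft = D.rest.cut P := by
      rw [toLeft_disjSum, ← TensorNetwork.logCost_empty]
      congr 1
    have hs0 : 0 ≤ Real.log (D.size j.1) := Real.log_nonneg (by exact_mod_cast D.size_pos j.1)
    have hm0 : 0 ≤ Real.log S.m := Real.log_nonneg (by exact_mod_cast S.m_pos)
    rw [h2] at h1
    split_ifs at h1 <;> linarith
  have hsum : T'.cost H ≤ Real.exp (H.logCost (P.disjSum ∅) {Sum.inr ()}) +
      ∑ p ∈ t.contractions, Real.exp (H.logCost (extend P p.1) (extend P p.2)) := by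
    rw [cost, hT'c]
    have hI : Set.InjOn (fun p : Finset VD × Finset VD => (extend P p.1, extend P p.2))
        t.contractions := by
      intro p _ p' _ h
      have h' := Prod.mk.inj h
      refine Prod.ext ?_ ?_
      · rw [← toLeft_extend P p.1, h'.1, toLeft_extend]
      · rw [← toLeft_extend P p.2, h'.2, toLeft_extend]
    rw [← sum_image (f := fun r : Finset (VD ⊕ Unit) × Finset (VD ⊕ Unit) =>
      Real.exp (H.logCost r.1 r.2)) hI]
    by_cases h : (P.disjSum ∅, {Sum.inr ()}) ∈
        t.contractions.image fun p => (extend P p.1, extend P p.2)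
    · rw [insert_eq_of_mem h]
      have := Real.exp_pos (H.logCost (P.disjSum ∅) {Sum.inr ()})
      linarith
    · rw [sum_insert h]
  calc Real.exp γ * D.sketchCost T₀ j S.m S.m_pos ≤ Real.exp γ * T'.cost H :=
        mul_le_mul_of_nonneg_left hle (Real.exp_pos γ).le
    _ ≤ Real.exp γ * (Real.exp (H.logCost (P.disjSum ∅) {Sum.inr ()}) +
          ∑ p ∈ t.contractions, Real.exp (H.logCost (extend P p.1) (extend P p.2))) :=
        mul_le_mul_of_nonneg_left hsum (Real.exp_pos γ).le
    _ = Real.exp (γ + H.logCost (P.disjSum ∅) {Sum.inr ()}) +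
          ∑ p ∈ t.contractions, Real.exp (γ + H.logCost (extend P p.1) (extend P p.2)) := by
        simp only [mul_add, mul_sum, Real.exp_add]
    _ ≤ S.expCost q₁ + ∑ p ∈ t.contractions, S.expCost (q p) := by
        refine add_le_add (Real.exp_le_exp.2 hcost₁) (sum_le_sum fun p hp => Real.exp_le_exp.2 ?_)
        obtain ⟨h1, h2⟩ := hmem p hp
        exact withMatrix_logCost_extend_le hT.1 hT₀.1 hγ ha hX hP hjP h1 h2 (hq p h1).1 (hq p h1).2
          fun h => hpure p h1 h _ (hq p h1).1 (hq p h1).2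
    -- The contraction `q₁` may coincide with a matched one, hence the factor 2.
    _ ≤ ∑ q ∈ touching T (D.subnet T₀ j), S.expCost q
        + ∑ q ∈ touching T (D.subnet T₀ j), S.expCost q := by
        refine add_le_add (single_le_sum (f := S.expCost) (fun x _ => expCost_nonneg x) hq₁)
          (sum_matching_le (hinj.mono fun p hp => (hmem p hp).1) fun p hp => ?_)
        obtain ⟨h1, h2⟩ := hmem p hp
        obtain ⟨h3, h4⟩ := hq p h1
        refine mem_filter.2 ⟨h3, Or.inl ⟨?_, ?_⟩⟩
        · rcases h4 with h4 | h4
          · exact h4.1 ▸ fst_nonempty h1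
          · exact h4.1 ▸ snd_nonempty h1
        · exact subset_union_left.trans (h4.union_eq ▸ h2)
    _ = _ := by ring

/-- Each contraction touches at most two of the disjoint subnetworks. -/
theorem sum_touching_le (T : ContractionTree (VD ⊕ VE)) {ι : Type*} [Fintype ι] [DecidableEq ι]
    (X : ι → Finset VD) (hX : ∀ i k, i ≠ k → Disjoint (X i) (X k)) :
    ∑ i, ∑ q ∈ touching T (X i), S.expCost q ≤ 2 * ∑ q ∈ T.contractions, S.expCost q := by
  -- A nonempty data part lies in at most one of the disjoint sets; this is applied to each of the
  -- two inputs.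
  have key : ∀ g : Finset (VD ⊕ VE) × Finset (VD ⊕ VE) → Finset (VD ⊕ VE),
      ∑ i, ∑ q ∈ T.contractions.filter (fun q => (g q).toLeft.Nonempty ∧ (g q).toLeft ⊆ X i),
        S.expCost q ≤ ∑ q ∈ T.contractions, S.expCost q := by
    intro g
    rw [← sum_biUnion]
    · exact sum_le_sum_of_subset_of_nonneg (biUnion_subset.2 fun i _ => filter_subset _ _)
        fun x _ _ => expCost_nonneg x
    · intro i _ k _ hik
      rw [Function.onFun, disjoint_left]
      intro q hq hq'
      obtain ⟨-, ⟨x, hx⟩, h1⟩ := mem_filter.1 hq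
      obtain ⟨-, -, h2⟩ := mem_filter.1 hq'
      exact disjoint_left.1 (hX i k hik) (h1 hx) (h2 hx)
  have h1 := key Prod.fst
  have h2 := key Prod.snd
  have h3 : ∀ i, ∑ q ∈ touching T (X i), S.expCost q ≤
      ∑ q ∈ T.contractions.filter (fun q => q.1.toLeft.Nonempty ∧ q.1.toLeft ⊆ X i), S.expCost q +
      ∑ q ∈ T.contractions.filter (fun q => q.2.toLeft.Nonempty ∧ q.2.toLeft ⊆ X i),
        S.expCost q := by
    intro i
    rw [touching, filter_or, ← sum_union_inter]
    have : 0 ≤ ∑ q ∈ T.contractions.filter (fun q => q.1.toLeft.Nonempty ∧ q.1.toLeft ⊆ X i) ∩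
      T.contractions.filter (fun q => q.2.toLeft.Nonempty ∧ q.2.toLeft ⊆ X i), S.expCost q :=
        sum_nonneg fun x _ => expCost_nonneg x
    linarith
  calc _ ≤ _ := sum_le_sum fun i _ => h3 i
    _ ≤ _ := by rw [sum_add_distrib]; linarith

end Embedding

/-! ### The lower bounds for the four terms. -/

namespace Embedding

open ContractionTree

variable {VD ED VE FE : Type*} [Fintype VD] [DecidableEq VD] [Fintype ED] [DecidableEq ED]
  [Fintype VE] [DecidableEq VE] [Fintype FE] [DecidableEq FE] {D : DataNetwork VD ED}
  {S : Embedding D VE FE} {σ : VE ≃ Fin (Fintype.card VE)}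

theorem sum_sketchCost_le {T : ContractionTree (VD ⊕ VE)} (hT : T.IsTreeOf univ)
    {T₀ : ContractionTree VD} (hT₀ : T₀.IsTreeOf univ) (hc : T.ConstrainedOn T₀) {γ : ℝ}
    (hγ : γ ≤ 0)
    (ha : ∀ v ∈ (S.directed σ).active, γ + Real.log S.m ≤ (S.directed σ).outW {v}) :
    Real.exp γ * ∑ j : D.Sketched, D.sketchCost T₀ j S.m S.m_pos ≤ 4 * T.cost S.network := by
  have h := sum_touching_le (S := S) T (fun j : D.Sketched => D.subnet T₀ j)
    fun j k hjk => DataNetwork.subnet_disjoint hT₀.1 hT₀.2 hjk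
  rw [mul_sum]
  refine (sum_le_sum fun j _ => sketchCost_le hT hT₀ hc hγ ha j).trans ?_
  rw [← mul_sum, show T.cost S.network = ∑ q ∈ T.contractions, S.expCost q from rfl]
  linarith

/-- Both inputs of the matching contraction contain some v_j, so each contributes a factor m up to
exp γ. -/
theorem sum_classS_le {T : ContractionTree (VD ⊕ VE)} (hT : T.IsTreeOf univ)
    {T₀ : ContractionTree VD} (hT₀ : T₀.IsTreeOf univ) (hc : T.ConstrainedOn T₀) {γ : ℝ}
    (ha : ∀ v ∈ (S.directed σ).active, γ + Real.log S.m ≤ (S.directed σ).outW {v}) :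
    Real.exp (2 * γ) * ∑ p ∈ D.classS T₀,
      D.aSize p * D.bSize p * D.cSize p * D.dSize p * (S.m : ℝ) ^ 2 ≤ T.cost S.network := by
  obtain ⟨q, hq, hinj⟩ := exists_matching hT₀.1 hc
  have hsub : D.classS T₀ ⊆ T₀.contractions := filter_subset _ _
  have hm : (0 : ℝ) < S.m := by exact_mod_cast S.m_pos
  refine le_trans ?_ (sum_matching_le (S := S) (F := T.contractions) (hinj.mono hsub)
    fun p hp => (hq p (hsub hp)).1)
  rw [mul_sum]
  refine sum_le_sum fun p hp => ?_
  obtain ⟨hp, ⟨j, hj⟩, ⟨k, hk⟩⟩ := mem_filter.1 hp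
  obtain ⟨h1, h2⟩ := hq p hp
  rw [DataNetwork.mem_sketchedAt] at hj hk
  have hG := S.le_logCost_of_matches (σ := σ) (hT.1.disjoint h1) h2
  have ho : γ + Real.log S.m ≤ (S.directed σ).outW (q p).1 ∧
      γ + Real.log S.m ≤ (S.directed σ).outW (q p).2 := by
    rcases h2 with ⟨h3, h4⟩ | ⟨h3, h4⟩
    · exact ⟨le_outW_of_vertex_mem ha (mem_toLeft.1 (h3 ▸ hj)),
        le_outW_of_vertex_mem ha (mem_toLeft.1 (h4 ▸ hk))⟩
    · exact ⟨le_outW_of_vertex_mem ha (mem_toLeft.1 (h3 ▸ hk)),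
        le_outW_of_vertex_mem ha (mem_toLeft.1 (h4 ▸ hj))⟩
  have hm2 : (S.m : ℝ) ^ 2 = Real.exp (2 * Real.log S.m) := by
    rw [two_mul, Real.exp_add, Real.exp_log hm, sq]
  rw [DataNetwork.abcd_eq, hm2, ← Real.exp_add, ← Real.exp_add]
  exact Real.exp_le_exp.2 (by linarith [ho.1, ho.2])

/-- If the output is adjacent to a sketched edge, one input emits γ + log m and the minimum is at
most m. Otherwise no embedding edge leaves the data set and the minimum is at most 1. -/
theorem sum_classI_le {T : ContractionTree (VD ⊕ VE)} (hT : T.IsTreeOf univ)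
    {T₀ : ContractionTree VD} (hT₀ : T₀.IsTreeOf univ) (hc : T.ConstrainedOn T₀) {γ : ℝ}
    (hγ : γ ≤ 0)
    (ha : ∀ v ∈ (S.directed σ).active, γ + Real.log S.m ≤ (S.directed σ).outW {v}) :
    Real.exp γ * ∑ p ∈ D.classI T₀, S.zCost σ p ≤ T.cost S.network := by
  obtain ⟨q, hq, hinj⟩ := exists_matching hT₀.1 hc
  have hsub : D.classI T₀ ⊆ T₀.contractions := filter_subset _ _
  have hm : (0 : ℝ) < S.m := by exact_mod_cast S.m_pos
  refine le_trans ?_ (sum_matching_le (S := S) (F := T.contractions) (hinj.mono hsub)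
    fun p hp => (hq p (hsub hp)).1)
  rw [mul_sum]
  refine sum_le_sum fun p hp => ?_
  obtain ⟨h1, h2⟩ := hq p (hsub hp)
  have hG := S.le_logCost_of_matches (σ := σ) (hT.1.disjoint h1) h2
  have ho1 := (S.directed σ).outW_nonneg (q p).1
  have ho2 := (S.directed σ).outW_nonneg (q p).2
  rw [zCost, DataNetwork.abcd_eq]
  have key : ∀ x, γ + (D.rest.logCost p.1 p.2 + x) ≤ S.network.logCost (q p).1 (q p).2 →
      min (Real.exp (S.cutLin σ ((p.1 ∪ p.2).disjSum ∅))) (S.m : ℝ) ≤ Real.exp x →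
      Real.exp γ * (Real.exp (D.rest.logCost p.1 p.2) *
        min (Real.exp (S.cutLin σ ((p.1 ∪ p.2).disjSum ∅))) (S.m : ℝ)) ≤ S.expCost (q p) := by
    intro x hx hmin
    refine le_trans ?_ (Real.exp_le_exp.2 hx)
    rw [Real.exp_add, Real.exp_add]
    gcongr
  by_cases hs : (D.sketchedAt (p.1 ∪ p.2)).Nonempty
  · obtain ⟨j, hj⟩ := hs
    rw [DataNetwork.mem_sketchedAt, ← h2.union_eq, mem_union, mem_toLeft, mem_toLeft] at hj
    refine key (Real.log S.m) ?_ ((min_le_right _ _).trans (Real.exp_log hm).ge)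
    rcases hj with hj | hj
    · have := le_outW_of_vertex_mem ha hj
      linarith
    · have := le_outW_of_vertex_mem ha hj
      linarith
  · refine key 0 (by linarith) ((min_le_left _ _).trans (Real.exp_le_exp.2 ?_))
    rw [cutLin_eq, DirectedNetwork.outW_eq_zero]
    rw [eq_empty_iff_forall_notMem]
    rintro (v | w) hx
    · obtain ⟨hv, hva⟩ := mem_inter.1 hx
      obtain ⟨j, rfl⟩ := inl_mem_active.1 hva
      exact hs ⟨j, DataNetwork.mem_sketchedAt.2 (by simpa using hv)⟩
    · simp at hx

/-- At the root the debit vanishes and the potential is at least N - 1, which is at least N/2 for N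
≥ 2; this turns the factor 3 into 6. -/
theorem order_mul_le {T : ContractionTree (VD ⊕ VE)} (hT : T.IsTreeOf univ) {γ : ℝ}
    (hγ : γ ≤ 0)
    (ha : ∀ v ∈ (S.directed σ).active, γ + Real.log S.m ≤ (S.directed σ).outW {v})
    (hs : ∀ e ∈ D.sketched, S.m < D.size e) (hN : 2 ≤ D.order) :
    Real.exp (4 * γ) * ((D.order : ℝ) * (S.m : ℝ) ^ (5 / 2 : ℝ)) ≤ 6 * T.cost S.network := by
  have hm : (0 : ℝ) < S.m := by exact_mod_cast S.m_pos
  have hm0 : 0 ≤ Real.log S.m := Real.log_nonneg (by exact_mod_cast S.m_pos)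
  have h := DirectedNetwork.potential_le_cost hγ hm0 ha (log_m_lt_outW_singleton hs) S.expCost
    (fun A B hAB => Real.exp_le_exp.2 ?_) T hT.1
  · rw [hT.2, card_sources_univ, DirectedNetwork.debit, if_neg] at h
    · have hcr : 0 ≤ (S.directed σ).credit (2 * γ + Real.log S.m / 2) univ := by
        rw [DirectedNetwork.credit]
        split_ifs <;> norm_num
      have hn : (D.order : ℝ) / 2 ≤ (D.order - 1 : ℕ) := by
        rw [Nat.cast_sub (by omega)]
        have : (2 : ℝ) ≤ D.order := by exact_mod_cast hN
        push_cast
        linarith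
      have hexp : Real.exp (4 * γ + 5 / 2 * Real.log S.m)
          = Real.exp (4 * γ) * (S.m : ℝ) ^ (5 / 2 : ℝ) := by
        rw [Real.exp_add, Real.rpow_def_of_pos hm, mul_comm (Real.log _)]
      have h2 : Real.exp (4 * γ + 5 / 2 * Real.log S.m) * ((D.order : ℝ) / 2) ≤
          3 * T.cost S.network :=
        (mul_le_mul_of_nonneg_left (by linarith) (Real.exp_pos _).le).trans h
      rw [hexp] at h2
      linarith
    · have := S.outW_univ (σ := σ)
      linarith
  · have h1 := S.le_logCost (σ := σ) hAB
    have hl : Disjoint A.toLeft B.toLeft := by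
      rw [disjoint_left] at hAB ⊢
      intro x hx hy
      exact hAB (mem_toLeft.1 hx) (mem_toLeft.1 hy)
    have h2 : 0 ≤ D.rest.logCost A.toLeft B.toLeft := by
      rw [D.rest_logCost_eq hl]
      exact sum_nonneg fun e _ => D.weight_nonneg e
    linarith

end Embedding

theorem theoremE2 (κ κ₁ κ₂ : ℝ) (hκ : 0 < κ) (hκ₁ : 0 < κ₁) (hκ₂ : 0 < κ₂) :
    ∃ C : ℝ, 0 < C ∧
      ∀ (VD ED VE FE : Type*) [Fintype VD] [DecidableEq VD] [Fintype ED] [DecidableEq ED]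
        [Fintype VE] [DecidableEq VE] [Fintype FE] [DecidableEq FE]
        (ε δ : ℝ), 0 < ε → 0 < δ → δ < 1 →
      -- the data and a data contraction tree
      ∀ (D : DataNetwork VD ED) (T₀ : ContractionTree VD), T₀.IsTreeOf Finset.univ →
      -- an embedding in `𝒢^(ε,δ)` whose sketch size is below the size of every sketched edge
      ∀ (S : Embedding D VE FE) (σ : VE ≃ Fin (Fintype.card VE)),
        S.Admissible σ κ κ₁ κ₂ ε δ →
        (∀ e ∈ D.sketched, S.m < D.size e) →
      -- a contraction tree of the overall network that is constrained on `T₀`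
      ∀ T : ContractionTree (VD ⊕ VE), T.IsTreeOf Finset.univ → T.ConstrainedOn T₀ →
        C * (∑ j : D.Sketched, D.sketchCost T₀ j S.m S.m_pos
            + ∑ p ∈ D.classS T₀, D.aSize p * D.bSize p * D.cSize p * D.dSize p * (S.m : ℝ) ^ 2
            + (if 2 ≤ D.order then (D.order : ℝ) * (S.m : ℝ) ^ (5 / 2 : ℝ) else 0)
            + ∑ p ∈ D.classI T₀, S.zCost σ p)
          ≤ T.cost S.network := by
  have hc0 : 0 < min 1 (κ / κ₂) := lt_min one_pos (div_pos hκ hκ₂)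
  set γ := Real.log (min 1 (κ / κ₂)) with hγdef
  have hγ : γ ≤ 0 := Real.log_nonpos hc0.le (min_le_left _ _)
  -- The four bounds have factors 4, 1, 6 and 1, with sum 12; the smallest of their prefactors is
  -- exp(4γ).
  refine ⟨Real.exp (4 * γ) / 12, by positivity, ?_⟩
  intro VD ED VE FE _ _ _ _ _ _ _ _ ε δ _ _ _ D T₀ hT₀ S σ hS hs T hT hc
  have ha := Embedding.le_outW_singleton hκ hκ₂ hS hs
  have h1 := Embedding.sum_sketchCost_le hT hT₀ hc hγ ha
  have h2 := Embedding.sum_classS_le hT hT₀ hc ha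
  have h3 := Embedding.sum_classI_le hT hT₀ hc hγ ha
  have hcost : 0 ≤ T.cost S.network := sum_nonneg fun _ _ => (Real.exp_pos _).le
  have h4 : Real.exp (4 * γ) * (if 2 ≤ D.order then (D.order : ℝ) * (S.m : ℝ) ^ (5 / 2 : ℝ) else 0)
      ≤ 6 * T.cost S.network := by
    split_ifs with hN
    · exact Embedding.order_mul_le hT hγ ha hs hN
    · rw [mul_zero]
      positivity
  -- Stated for `x` of either sign, this spares proving that the sums are nonnegative.
  have weaken : ∀ k x y : ℝ, 0 ≤ y → 4 * γ ≤ k → Real.exp k * x ≤ y → Real.exp (4 * γ) * x ≤ y := by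
    intro k x y hy hk hx
    rcases le_total 0 x with h0 | h0
    · exact (mul_le_mul_of_nonneg_right (Real.exp_le_exp.2 hk) h0).trans hx
    · exact (mul_nonpos_of_nonneg_of_nonpos (Real.exp_pos _).le h0).trans hy
  have h1' := weaken _ _ _ (by positivity) (by linarith) h1
  have h2' := weaken _ _ _ hcost (by linarith) h2
  have h3' := weaken _ _ _ hcost (by linarith) h3
  linarith
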